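/- **Setting.** Let $G=(V,E)$ be a finite connected simple undirected graph with $n\ge 2$ vertices, adjacency matrix $A$, degrees $d_v$ and degree matrix $D$. Let $s,t\in V$, $d=\min\{d_s,d_t\}$, $\epsilon\in(0,1)$ and let $L\ge 1$ be an integer. For $u\in V$ put $$\mathbf p_{L,u}=\tfrac12\sum_{l=0}^{L}\left(\tfrac12 I+\tfrac12 AD^{-1}\right)^l\mathbf e_u .$$ The graph is given by adjacency lists: a degree query and a neighbor query take unit time, and so do drawing a uniform element of a finite range, an arithmetic operation or comparison, an access to a memory cell, and a step of loop or list bookkeeping. **Algorithm 1.** Set $r_{max}=\epsilon/\sqrt d$. *Stage I (CGD).* For each $u\in\{s,t\}$ start with $\mathbf q_{L,u}=0$, $\mathbf r_{0,u}=\frac12\mathbf e_u$ and $\mathbf r_{i,u}=0$ for $i\ge1$. For $i=0,\dots,L$, as long as some $w$ has $\mathbf r_{i,u}(w)>\frac{r_{max}}{L^2}d_w$: add $\mathbf r_{i,u}(w)$ to $\mathbf q_{L,u}(w)$, add $\frac{1}{2d_w}\mathbf r_{i,u}(w)$ to $\mathbf r_{i+1,u}(v)$ for every neighbor $v$ of $w$,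 add $\frac12\mathbf r_{i,u}(w)$ to $\mathbf r_{i+1,u}(w)$, and set $\mathbf r_{i,u}(w)=0$. *Stage II (lazy random walks).* Start with $\hat{\mathbf p}_{L,u}(v)=\mathbf q_{L,u}(v)$ for $u,v\in\{s,t\}$, and let $n_r=\lceil\frac{4L^2}{\epsilon^2}r_{max}\,d\log n\rceil$. From each $v\in\{s,t\}$ perform $n_r$ independent lazy random walks of length $L$ (at each step stay with probability $\frac12$, otherwise move to a uniform neighbor). Whenever a walk from $v$ is at a vertex $w$ at step $k\in\{0,\dots,L\}$, add $\frac{d_v}{n_r}\sum_{i=0}^{L-k}\frac{\mathbf r_{i,u}(w)}{d_w}$ to $\hat{\mathbf p}_{L,u}(v)$, for both $u\in\{s,t\}$. Output the four numbers $\hat{\mathbf p}_{L,u}(v)$, $u,v\in\{s,t\}$. **Theorem.** There is an absolute constant $C>0$ such that the following holds. (1) For all $G,s,t,\epsilon,L$ as above and every ordering of the adjacency lists, with probability at least $1-C/n$, $$\frac{|\mathbf p_{L,u}(v)-\hat{\mathbf p}_{L,u}(v)|}{d_v}\le\frac{\epsilon}{d}\qquad\text{for all }u,v\in\{s,t\}\text{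 simultaneously},$$ and the running time of Algorithm 1 is always at most $C\,L^4\log n\cdot\frac{\sqrt d}{\epsilon}$. (2) On expanders the running time is $\tilde O(\sqrt d/\epsilon)$. Precisely, let $\phi_G=\min_{\emptyset\ne S\subsetneq V}\frac{|E(S,V\setminus S)|}{\min\{\sum_{u\in S}d_u,\ \sum_{u\notin S}d_u\}}$ be the conductance, let $\kappa$ be the ratio of the largest to the smallest non-zero eigenvalue of the normalized Laplacian $D^{-1/2}(D-A)D^{-1/2}$, and let $L=\lceil 2\kappa\log\frac n\epsilon\rceil$. For every $K>0$ and $a\in\mathbb N$ there are $C'>0$ and $a'\in\mathbb N$ such that for all $G,s,t,\epsilon$ as above with $\phi_G\ge\left(K\log^{a}\frac n\epsilon\right)^{-1}$ and every ordering of the adjacency lists, Algorithm 1 with this $L$ satisfies the error bound of (1) with probability at least $1-C/n$, and its running time is always at most $C'\log^{a'}\!\left(\frac n\epsilon\right)\cdot\frac{\sqrt d}{\epsilon}$. -/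

import Mathlib

noncomputable section

namespace LocalER

/-! ## Graph quantities -/

section Graph

variable {V : Type} [Fintype V] [DecidableEq V] (G : SimpleGraph V) [DecidableRel G.Adj]

/-- The lazy random walk matrix `(1/2) I + (1/2) A D⁻¹` (it acts on column vectors). -/
def lazyWalkMatrix : Matrix V V ℝ :=
  (1 / 2 : ℝ) • (1 : Matrix V V ℝ) +
    (1 / 2 : ℝ) • (G.adjMatrix ℝ * Matrix.diagonal fun v => ((G.degree v : ℝ))⁻¹)

/-- `p_{L,u}(v)`, where `p_{L,u} = (1/2) ∑_{l=0}^{L} ((1/2) I + (1/2) A D⁻¹)^l e_u`. -/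
def pL (L : ℕ) (u v : V) : ℝ :=
  (1 / 2 : ℝ) *
    ∑ l ∈ Finset.range (L + 1), ((lazyWalkMatrix G ^ l).mulVec (Pi.single u 1)) v

/-- The normalized Laplacian `D^{-1/2} (D - A) D^{-1/2}`. -/
def normLap : Matrix V V ℝ :=
  (Matrix.diagonal fun v => (√(G.degree v : ℝ))⁻¹) * G.lapMatrix ℝ *
    Matrix.diagonal fun v => (√(G.degree v : ℝ))⁻¹

/-- The condition number of the normalized Laplacian: its largest eigenvalue divided by its
smallest non-zero eigenvalue. -/
def kappa : ℝ :=
  sSup (spectrum ℝ (normLap G)) / sInf (spectrum ℝ (normLap G) \ {0})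

/-- The conductance: the minimum over proper non-empty vertex sets `S` of the number of edges
leaving `S`, divided by the smaller of the volumes of `S` and of its complement. -/
def conductance : ℝ :=
  ⨅ S : {S : Finset V // S.Nonempty ∧ Sᶜ.Nonempty},
    ((G.interedges S.1 S.1ᶜ).card : ℝ) /
      min (∑ u ∈ S.1, (G.degree u : ℝ)) (∑ u ∈ S.1ᶜ, (G.degree u : ℝ))

/-- The truncation length `⌈2 κ log (n / ε)⌉`. -/
def truncLen (ε : ℝ) : ℕ :=
  ⌈2 * kappa G * Real.log ((Fintype.card V : ℝ) / ε)⌉₊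

end Graph

/-! ## A randomized unit-cost machine with adjacency-list access

A program is a tree of instructions.  The graph can be reached only through degree and neighbor
queries, the memory only through `load` and `store`, and randomness only through `random`; each
instruction costs one unit of time. -/

/-- Memory cells (tables of reals).  The flag `b` tells whether the source is `s` (`false`) or
`t` (`true`), and likewise the flag `c` for the target. -/
inductive Cell (V : Type) : Type
  /-- the residual `r_{i,u}(w)`, where `u` is the source with flag `b` -/
  | res (b : Bool) (i : ℕ) (w : V)
  /-- the coarse approximation `q_{L,u}(w)`, where `u` is the source with flag `b` -/
  | est (b : Bool) (w : V)
  /-- the estimate of `p_{L,u}(v)`, where `u` has flag `b` and `v` has flag `c` -/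
  | out (b c : Bool)

/-- The contents of the memory. -/
abbrev Mem (V : Type) : Type := Cell V → ℝ

/-- Binary arithmetic operations. -/
inductive BinOp : Type
  | add
  | mul
  | div

/-- The value of a binary arithmetic operation. -/
def BinOp.eval : BinOp → ℝ → ℝ → ℝ
  | .add, x, y => x + y
  | .mul, x, y => x * y
  | .div, x, y => x / y

/-- The instructions, each of unit cost. -/
inductive Instr (V : Type) : Type
  /-- the degree of `u` -/
  | degree (u : V)
  /-- the `i`-th neighbor of `u`, counted from `0` -/
  | neighbor (u : V) (i : ℕ)
  /-- a uniform element of `{0, …, k - 1}` -/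
  | random (k : ℕ)
  | arith (o : BinOp) (x y : ℝ)
  | sqrt (x : ℝ)
  | log (x : ℝ)
  /-- rounding up to a natural number -/
  | ceil (x : ℝ)
  /-- the test `x < y` -/
  | less (x y : ℝ)
  | load (a : Cell V)
  | store (a : Cell V) (x : ℝ)
  /-- bookkeeping: one iteration of a loop, or one insertion into a linked list -/
  | tick

/-- The type of the answer to an instruction. -/
def Instr.Resp {V : Type} : Instr V → Type
  | .degree _ => ℕ
  | .neighbor _ _ => V
  | .random _ => ℕ
  | .arith _ _ _ => ℝ
  | .sqrt _ => ℝ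
  | .log _ => ℝ
  | .ceil _ => ℕ
  | .less _ _ => Bool
  | .load _ => ℝ
  | .store _ _ => Unit
  | .tick => Unit

/-- Programs with a result of type `α`. -/
inductive Prog (V : Type) (α : Type) : Type
  | done (a : α)
  | exec (o : Instr V) (k : o.Resp → Prog V α)

/-- Sequential composition. -/
def Prog.bind {V α β : Type} : Prog V α → (α → Prog V β) → Prog V β
  | .done a, f => f a
  | .exec o k, f => .exec o fun r => (k r).bind f

instance {V : Type} : Monad (Prog V) where
  pure := Prog.done
  bind := Prog.bind

section Semantics

variable {V : Type} [Fintype V] [DecidableEq V] (G : SimpleGraph V) [DecidableRel G.Adj]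

/-- Adjacency lists of `G`: for every vertex an (arbitrary) enumeration of its neighbors. -/
abbrev AdjLists : Type := ∀ u : V, Fin (G.degree u) ≃ G.neighborSet u

variable {G}

open Classical in
/-- The effect of one instruction: the joint law of its answer and of the new memory. -/
def Instr.sem (N : AdjLists G) : (o : Instr V) → Mem V → PMF (o.Resp × Mem V)
  | .degree u, M => PMF.pure (G.degree u, M)
  | .neighbor u i, M =>
      PMF.pure (if h : i < G.degree u then (N u ⟨i, h⟩ : V) else u, M)
  | .random k, M =>
      if h : 0 < k then
        haveI : Nonempty (Fin k) := ⟨⟨0, h⟩⟩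
        (PMF.uniformOfFintype (Fin k)).map fun j => ((j : ℕ), M)
      else PMF.pure ((0 : ℕ), M)
  | .arith o x y, M => PMF.pure (o.eval x y, M)
  | .sqrt x, M => PMF.pure (√x, M)
  | .log x, M => PMF.pure (Real.log x, M)
  | .ceil x, M => PMF.pure (⌈x⌉₊, M)
  | .less x y, M => PMF.pure (decide (x < y), M)
  | .load a, M => PMF.pure (M a, M)
  | .store a x, M => PMF.pure ((), Function.update M a x)
  | .tick, M => PMF.pure ((), M)

/-- The outcome of an execution: result, final memory, number of executed instructions. -/
structure Outcome (V α : Type) : Type where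
  result : α
  mem : Mem V
  time : ℕ

/-- The law of the outcome of a program started in a given memory. -/
def Prog.run (N : AdjLists G) {α : Type} : Prog V α → Mem V → PMF (Outcome V α)
  | .done a, M => PMF.pure ⟨a, M, 0⟩
  | .exec o k, M =>
      (o.sem N M).bind fun rM =>
        ((k rM.1).run N rM.2).map fun x => ⟨x.result, x.mem, x.time + 1⟩

end Semantics

/-! ## The algorithm -/

section Algorithm

variable {V : Type}

def degreeQ (u : V) : Prog V ℕ := .exec (.degree u) .done
def neighborQ (u : V) (i : ℕ) : Prog V V := .exec (.neighbor u i) .done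
def random (k : ℕ) : Prog V ℕ := .exec (.random k) .done
def add (x y : ℝ) : Prog V ℝ := .exec (.arith .add x y) .done
def mul (x y : ℝ) : Prog V ℝ := .exec (.arith .mul x y) .done
def div (x y : ℝ) : Prog V ℝ := .exec (.arith .div x y) .done
def sqrtOp (x : ℝ) : Prog V ℝ := .exec (.sqrt x) .done
def logOp (x : ℝ) : Prog V ℝ := .exec (.log x) .done
def ceilOp (x : ℝ) : Prog V ℕ := .exec (.ceil x) .done
def less (x y : ℝ) : Prog V Bool := .exec (.less x y) .done
def load (a : Cell V) : Prog V ℝ := .exec (.load a) .done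
def store (a : Cell V) (x : ℝ) : Prog V Unit := .exec (.store a x) .done
def tick : Prog V Unit := .exec .tick .done

/-- `r_i(v) ← r_i(v) + x`; the vertex `v` enters the worklist `Q` of level `i` at the moment when
`r_i(v)` first exceeds `ρ d_v`. -/
def addResidual (b : Bool) (i : ℕ) (ρ : ℝ) (v : V) (x : ℝ) (Q : List V) :
    Prog V (List V) := do
  let old ← load (.res b i v)
  let new ← add old x
  store (.res b i v) new
  let dv ← degreeQ v
  let bound ← mul ρ dv
  let before ← less bound old
  let after ← less bound new
  if after && !before then do
    tick
    pure (v :: Q)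
  else
    pure Q

/-- `r_i(v) ← r_i(v) + x` for the first `m` neighbors `v` of `w`. -/
def pushNeighbors (b : Bool) (i : ℕ) (ρ : ℝ) (w : V) (x : ℝ) :
    ℕ → List V → Prog V (List V)
  | 0, Q => pure Q
  | m + 1, Q => do
      tick
      let v ← neighborQ w m
      let Q' ← addResidual b i ρ v x Q
      pushNeighbors b i ρ w x m Q'

/-- The push operation on `(w, i)`; `Q` is the worklist of level `i + 1`. -/
def pushVertex (b : Bool) (i : ℕ) (ρ : ℝ) (w : V) (Q : List V) : Prog V (List V) := do
  let x ← load (.res b i w)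
  let q ← load (.est b w)
  let q' ← add q x
  store (.est b w) q'
  let dw ← degreeQ w
  let half ← div x 2
  let share ← div half dw
  let Q₁ ← pushNeighbors b (i + 1) ρ w share dw Q
  let Q₂ ← addResidual b (i + 1) ρ w half Q₁
  store (.res b i w) 0
  pure Q₂

/-- Push every vertex of the worklist of level `i`; returns the worklist of level `i + 1`.
A push at level `i` changes residuals of level `i` only by setting that of the pushed vertex
to `0`, so afterwards no residual of level `i` exceeds its threshold. -/
def pushLevel (b : Bool) (i : ℕ) (ρ : ℝ) : List V → List V → Prog V (List V)
  | [], Q => pure Q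
  | w :: W, Q => do
      tick
      let Q' ← pushVertex b i ρ w Q
      pushLevel b i ρ W Q'

/-- Process `m` levels, starting with level `i`, whose worklist is `W`. -/
def pushLevels (b : Bool) (ρ : ℝ) : ℕ → ℕ → List V → Prog V Unit
  | _, 0, _ => pure ()
  | i, m + 1, W => do
      tick
      let Q ← pushLevel b i ρ W []
      pushLevels b ρ (i + 1) m Q

/-- Coordinate gradient descent from the source `u` (with flag `b`): starting from
`r_0 = (1/2) e_u`, for `i = 0, …, L`, push every `w` with `r_i(w) > (r_max / L²) d_w`. -/
def cgd (b : Bool) (u : V) (L : ℕ) (rmax : ℝ) : Prog V Unit := do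
  let L2 ← mul L L
  let ρ ← div rmax L2
  let W ← addResidual b 0 ρ u (1 / 2) []
  pushLevels b ρ 0 (L + 1) W

/-- `acc + ∑_{i < m} r_i(w)`. -/
def residualSum (b : Bool) (w : V) : ℕ → ℝ → Prog V ℝ
  | 0, acc => pure acc
  | m + 1, acc => do
      tick
      let r ← load (.res b m w)
      let acc' ← add acc r
      residualSum b w m acc'

/-- The update of one estimate by a walk at `w` with `m` steps to go:
add `scale * ∑_{i=0}^{m} r_i(w) / d_w`. -/
def updateEstimate (b c : Bool) (scale : ℝ) (w : V) (m : ℕ) : Prog V Unit := do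
  let S ← residualSum b w (m + 1) 0
  let dw ← degreeQ w
  let x ← div S dw
  let y ← mul scale x
  let old ← load (.out b c)
  let new ← add old y
  store (.out b c) new

/-- One step of the lazy random walk. -/
def lazyStep (w : V) : Prog V V := do
  let coin ← random 2
  if coin = 0 then do
    let dw ← degreeQ w
    let j ← random dw
    neighborQ w j
  else
    pure w

/-- A lazy random walk of length `m` from `w`, updating the estimates with target flag `c` at
every visited vertex, including the first and the last. -/
def walk (c : Bool) (scale : ℝ) : ℕ → V → Prog V Unit
  | 0, w => do
      tick
      updateEstimate false c scale w 0
      updateEstimate true c scale w 0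
  | m + 1, w => do
      tick
      updateEstimate false c scale w (m + 1)
      updateEstimate true c scale w (m + 1)
      let w' ← lazyStep w
      walk c scale m w'

/-- `k` rounds of sampling, each with one walk from `s` and one from `t`. -/
def sample (s t : V) (L : ℕ) (scaleS scaleT : ℝ) : ℕ → Prog V Unit
  | 0 => pure ()
  | k + 1 => do
      tick
      walk false scaleS L s
      walk true scaleT L t
      sample s t L scaleS scaleT k

/-- Initialize an estimate by the coarse approximation. -/
def initEstimate (b c : Bool) (v : V) : Prog V Unit := do
  let q ← load (.est b v)
  store (.out b c) q

/-- The two-stage algorithm on a graph with `n` vertices.  The result at `(b, c)` is the estimate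
of `p_{L,u}(v)`, where `u` is `s` or `t` according to `b`, and `v` is `s` or `t` according
to `c`. -/
def bidirectional (n : ℕ) (s t : V) (L : ℕ) (ε : ℝ) : Prog V (Bool → Bool → ℝ) := do
  -- stage I: deterministic search
  let ds ← degreeQ s
  let dt ← degreeQ t
  let swap ← less dt ds
  let d : ℕ := if swap then dt else ds
  let sd ← sqrtOp d
  let rmax ← div ε sd
  cgd false s L rmax
  cgd true t L rmax
  initEstimate false false s
  initEstimate false true t
  initEstimate true false s
  initEstimate true true t
  -- stage II: `n_r = ⌈(4 L² / ε²) r_max d log n⌉` random walks from each of `s` and `t`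
  let L2 ← mul L L
  let x₁ ← mul 4 L2
  let ε2 ← mul ε ε
  let x₂ ← div x₁ ε2
  let x₃ ← mul x₂ rmax
  let x₄ ← mul x₃ d
  let ln ← logOp n
  let x₅ ← mul x₄ ln
  let nr ← ceilOp x₅
  let scaleS ← div ds nr
  let scaleT ← div dt nr
  sample s t L scaleS scaleT nr
  let ss ← load (.out false false)
  let st ← load (.out false true)
  let ts ← load (.out true false)
  let tt ← load (.out true true)
  pure fun b c => if b then (if c then tt else ts) else (if c then st else ss)

end Algorithm

/-! ## The two guarantees -/

section Guarantees

variable {V : Type} [Fintype V] [DecidableEq V] {G : SimpleGraph V} [DecidableRel G.Adj]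

/-- The law of the outcome of the algorithm, started with an all-zero memory. -/
def algorithmLaw (N : AdjLists G) (s t : V) (L : ℕ) (ε : ℝ) :
    PMF (Outcome V (Bool → Bool → ℝ)) :=
  (bidirectional (Fintype.card V) s t L ε).run N fun _ => 0

/-- The vertex with a given flag: `s` for `false`, `t` for `true`. -/
def endpoint (s t : V) (b : Bool) : V := if b then t else s

/-- `min {d_s, d_t}`. -/
def minDeg (G : SimpleGraph V) [DecidableRel G.Adj] (s t : V) : ℕ :=
  min (G.degree s) (G.degree t)

/-- With probability at least `1 - δ`, simultaneously for all `u, v ∈ {s, t}`, the estimate of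
`p_{L,u}(v)` has an error of at most `(ε / d) d_v`. -/
def AccurateWithProb (N : AdjLists G) (s t : V) (L : ℕ) (ε δ : ℝ) : Prop :=
  ENNReal.ofReal (1 - δ) ≤ (algorithmLaw N s t L ε).toOuterMeasure
    {x | ∀ b c : Bool,
      |pL G L (endpoint s t b) (endpoint s t c) - x.result b c| / G.degree (endpoint s t c)
        ≤ ε / minDeg G s t}

/-- Every possible execution takes at most `T` units of time. -/
def RunsWithin (N : AdjLists G) (s t : V) (L : ℕ) (ε T : ℝ) : Prop :=
  ∀ x ∈ (algorithmLaw N s t L ε).support, (x.time : ℝ) ≤ T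

end Guarantees

end LocalER

end

/-! The deterministic stage splits the law of the walk. At each level the mass above the threshold
is pushed one step further and the rest stays as a leftover residual, at most `ρ d_w` at `w`, where
`ρ = ε / (√d L²)`. Dividing by degrees turns the forward evolution of mass into averaging over
neighbors, because the lazy walk is reversible (`forward_div`). Hence the part of the law missed by
the pushes is the expectation of the leftovers, divided by degrees, seen along a walk started at the
target, and the sampled correction is unbiased (`pathMean_unitIncrement`, `pL_div_sub`).

For concentration, apart from its deterministic first visit, a walk contributes a nonnegative
variable bounded by `L² ρ = ε / √d`. Its mean is at most `L / (2 d_u)`, since averaging keeps the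
density of the law below its initial maximum (`heat_le`). A variable in `[0, B]` with mean `μ` has
second moment at most `B μ`. This gives a Bernstein-type bound on the moment generating function
(`pathMean_exp_le`). Independence of the rounds makes the generating function of an estimate a power
(`mean_sample`), exponential Markov with parameter `√d / L` gives failure probability `1 / n` for
each sign of each estimate (`tail_bound`), and a union bound over eight events finishes.

For the running time, a push at `w` costs `O(d_w)` and consumes residual mass above `ρ d_w`, while a
level carries mass at most `1/2`; so a level costs `O(1 / ρ)` (`holds_pushLevels`). Each of the
walks costs `O(L²)`, because every visit sums up to `L + 1` residuals.

These facts reach the machine through two recursive semantics: `Prog.Holds` quantifies over all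
executions with memory and time, `Prog.mean` computes expectations. Both are compositional and are
tied to the actual law by `Prog.Holds.of_mem_support` and `Prog.toOuterMeasure_run_le`.

For expanders, Cheeger's inequality bounds the nonzero eigenvalues of the normalized Laplacian below
by `φ² / 2`, and all eigenvalues are at most `2`, so `κ ≤ 4 / φ²` (`kappa_bounds`). The truncation
length is then polylogarithmic and the general bound applies. -/

noncomputable section

set_option linter.unusedSectionVars false

namespace LocalER

/-! ### Program logic: all executions, expectations, and the link to the law. -/

section Logic

variable {V : Type} [Fintype V] {G : SimpleGraph V} [DecidableRel G.Adj]
variable (N : AdjLists G) {α β : Type}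

/-- The neighbor of `u` at position `i` of its adjacency list (and `u` itself if there is none). -/
def AdjLists.nbr (N : AdjLists G) (u : V) (i : ℕ) : V :=
  if h : i < G.degree u then (N u ⟨i, h⟩ : V) else u

open Classical in
/-- The memory after writing `x` into the cell `a`. -/
def Mem.set (M : Mem V) (a : Cell V) (x : ℝ) : Mem V := Function.update M a x

theorem Mem.set_self (M : Mem V) (a : Cell V) (x : ℝ) : M.set a x a = x := by
  simp [Mem.set]

theorem Mem.set_of_ne (M : Mem V) {a b : Cell V} (h : b ≠ a) (x : ℝ) : M.set a x b = M b := by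
  simp [Mem.set, h]

/-- The expectation of a function of the answer and the new memory. -/
def Instr.mean : (o : Instr V) → Mem V → (o.Resp → Mem V → ℝ) → ℝ
  | .degree u, M, F => F (G.degree u) M
  | .neighbor u i, M, F => F (N.nbr u i) M
  | .random k, M, F =>
      if 0 < k then (∑ j ∈ Finset.range k, F j M) / k else F (0 : ℕ) M
  | .arith o x y, M, F => F (o.eval x y) M
  | .sqrt x, M, F => F √x M
  | .log x, M, F => F (Real.log x) M
  | .ceil x, M, F => F ⌈x⌉₊ M
  | .less x y, M, F => F (decide (x < y)) M
  | .load a, M, F => F (M a) M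
  | .store a x, M, F => F () (M.set a x)
  | .tick, M, F => F () M

/-- The expectation of a function of the result and the final memory of a program. -/
def Prog.mean : Prog V α → Mem V → (α → Mem V → ℝ) → ℝ
  | .done a, M, F => F a M
  | .exec o k, M, F => o.mean N M fun r M' => (k r).mean M' F

/-- The property `Q` holds for the answer and the new memory, whatever the random choice. -/
def Instr.Holds : (o : Instr V) → Mem V → (o.Resp → Mem V → Prop) → Prop
  | .degree u, M, Q => Q (G.degree u) M
  | .neighbor u i, M, Q => Q (N.nbr u i) M
  -- A draw from an empty range answers `0`, hence the separate clause.
  | .random k, M, Q => (k = 0 → Q (0 : ℕ) M) ∧ ∀ j < k, Q j M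
  | .arith o x y, M, Q => Q (o.eval x y) M
  | .sqrt x, M, Q => Q √x M
  | .log x, M, Q => Q (Real.log x) M
  | .ceil x, M, Q => Q ⌈x⌉₊ M
  | .less x y, M, Q => Q (decide (x < y)) M
  | .load a, M, Q => Q (M a) M
  | .store a x, M, Q => Q () (M.set a x)
  | .tick, M, Q => Q () M

/-- The property `Q` of the result, the final memory and the running time holds for every
execution. -/
def Prog.Holds : Prog V α → Mem V → (α → Mem V → ℕ → Prop) → Prop
  | .done a, M, Q => Q a M 0
  | .exec o k, M, Q =>
      o.Holds N M fun r M' => (k r).Holds M' fun a M'' n => Q a M'' (n + 1)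

theorem Instr.Holds.mono {o : Instr V} {M : Mem V} {P Q : o.Resp → Mem V → Prop}
    (h : o.Holds N M P) (hPQ : ∀ r M', P r M' → Q r M') : o.Holds N M Q := by
  cases o <;> first
    | exact hPQ _ _ h
    | exact ⟨fun hk => hPQ _ _ (h.1 hk), fun j hj => hPQ _ _ (h.2 j hj)⟩

theorem Prog.Holds.mono {p : Prog V α} {M : Mem V} {P Q : α → Mem V → ℕ → Prop}
    (h : p.Holds N M P) (hPQ : ∀ a M' n, P a M' n → Q a M' n) : p.Holds N M Q := by
  induction p generalizing M P Q with
  | done a => exact hPQ _ _ _ h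
  | exec o k ih =>
    exact Instr.Holds.mono N h fun r M' hr => ih r hr fun a M'' n => hPQ a M'' (n + 1)

theorem Prog.holds_bind (p : Prog V α) (f : α → Prog V β) (M : Mem V)
    (Q : β → Mem V → ℕ → Prop) :
    (p >>= f).Holds N M Q ↔
      p.Holds N M fun a M' m => (f a).Holds N M' fun b M'' n => Q b M'' (m + n) := by
  induction p generalizing M Q with
  | done a =>
    change (f a).Holds N M Q ↔ (f a).Holds N M _
    simp
  | exec o k ih =>
    change (o.Holds N M fun r M' => (k r >>= f).Holds N M' _) ↔ o.Holds N M fun r M' => _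
    simp only [ih]
    simp only [add_right_comm]

theorem Prog.mean_bind (p : Prog V α) (f : α → Prog V β) (M : Mem V) (F : β → Mem V → ℝ) :
    (p >>= f).mean N M F = p.mean N M fun a M' => (f a).mean N M' F := by
  induction p generalizing M with
  | done a => rfl
  | exec o k ih =>
    change (o.mean N M fun r M' => (k r >>= f).mean N M' _) = o.mean N M fun r M' => _
    simp only [ih]

/-- Only reachable outcomes matter for an expectation. This lets invariants proved with `Prog.Holds`
be used inside expectations. -/
theorem Prog.mean_le_mean {p : Prog V α} {M : Mem V} {F F' : α → Mem V → ℝ}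
    (h : p.Holds N M fun a M' _ => F a M' ≤ F' a M') : p.mean N M F ≤ p.mean N M F' := by
  induction p generalizing M with
  | done a => exact h
  | exec o k ih =>
    cases o with
    | random m =>
      change Instr.mean N _ M _ ≤ Instr.mean N _ M _
      simp only [Instr.mean]
      split_ifs with hm
      · gcongr with j hj
        exact ih _ (h.2 j (Finset.mem_range.1 hj))
      · exact ih _ (h.1 (by omega))
    | _ => exact ih _ h

theorem Prog.mean_congr {p : Prog V α} {M : Mem V} {F F' : α → Mem V → ℝ}
    (h : p.Holds N M fun a M' _ => F a M' = F' a M') : p.mean N M F = p.mean N M F' :=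
  le_antisymm (mean_le_mean N (h.mono N fun _ _ _ e => e.le))
    (mean_le_mean N (h.mono N fun _ _ _ e => e.ge))

theorem Prog.mean_const (p : Prog V α) (M : Mem V) (c : ℝ) : p.mean N M (fun _ _ => c) = c := by
  induction p generalizing M with
  | done a => rfl
  | exec o k ih =>
    change (o.mean N M fun r M' => (k r).mean N M' fun _ _ => c) = c
    simp only [ih]
    cases o with
    | random m =>
      simp only [Instr.mean]
      split_ifs with hm
      · have : (m : ℝ) ≠ 0 := by positivity
        simp; field_simp
      · rfl
    | _ => rfl

theorem Prog.mean_mul_const (p : Prog V α) (M : Mem V) (F : α → Mem V → ℝ) (c : ℝ) :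
    p.mean N M (fun a M' => F a M' * c) = p.mean N M F * c := by
  induction p generalizing M with
  | done a => rfl
  | exec o k ih =>
    change (o.mean N M fun r M' => (k r).mean N M' _) = (o.mean N M fun r M' => _) * c
    simp only [ih]
    cases o with
    | random m =>
      simp only [Instr.mean]
      split_ifs with hm
      · rw [← Finset.sum_mul]; ring
      · rfl
    | _ => rfl

theorem Prog.run_random (m : ℕ) (k : ℕ → Prog V α) (M : Mem V) (hm : 0 < m) :
    have : Nonempty (Fin m) := ⟨⟨0, hm⟩⟩
    (Prog.exec (.random m) k).run N M =
      (PMF.uniformOfFintype (Fin m)).bind fun j =>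
        ((k j).run N M).map fun x => ⟨x.result, x.mem, x.time + 1⟩ := by
  simp only [Prog.run, Instr.sem, hm, dite_true]
  change PMF.bind (PMF.map _ (PMF.bind _ fun a => PMF.pure _)) _ = _
  erw [PMF.bind_map, PMF.bind_bind]
  refine congrArg _ (funext fun j => ?_)
  erw [PMF.pure_bind]
  rfl

theorem Prog.run_random_zero (k : ℕ → Prog V α) (M : Mem V) :
    (Prog.exec (.random 0) k).run N M =
        ((k 0).run N M).map fun x => ⟨x.result, x.mem, x.time + 1⟩ := by
  simp only [Prog.run, Instr.sem]
  erw [PMF.pure_bind]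

theorem Prog.Holds.of_mem_support {p : Prog V α} {M : Mem V} {Q : α → Mem V → ℕ → Prop}
    (h : p.Holds N M Q) (x : Outcome V α) (hx : x ∈ (p.run N M).support) :
    Q x.result x.mem x.time := by
  induction p generalizing M Q x with
  | done a =>
    rw [Prog.run, PMF.support_pure, Set.mem_singleton_iff] at hx
    subst hx
    exact h
  | exec o k ih =>
    cases o with
    | random m =>
      rcases Nat.eq_zero_or_pos m with rfl | hm
      · rw [Prog.run_random_zero N k M, PMF.support_map] at hx
        obtain ⟨y, hy, rfl⟩ := hx
        exact ih _ (h.1 rfl) y hy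
      · rw [Prog.run_random N m k M hm, PMF.mem_support_bind_iff] at hx
        obtain ⟨j, -, hj⟩ := hx
        rw [PMF.support_map] at hj
        obtain ⟨y, hy, rfl⟩ := hj
        exact ih _ (h.2 j j.2) y hy
    | _ =>
      simp only [Prog.run, Instr.sem] at hx
      erw [PMF.pure_bind, PMF.support_map] at hx
      obtain ⟨y, hy, rfl⟩ := hx
      exact ih _ h y hy

/-- Markov's inequality: the probability of `S` is at most the expectation of any non-negative
function that is at least `1` on `S`. -/
theorem Prog.toOuterMeasure_run_le (p : Prog V α) (M : Mem V) (S : α → Mem V → Prop)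
    (F : α → Mem V → ℝ) (hF : ∀ a M', 0 ≤ F a M') (hS : ∀ a M', S a M' → 1 ≤ F a M') :
    (p.run N M).toOuterMeasure {x | S x.result x.mem} ≤ ENNReal.ofReal (p.mean N M F) := by
  -- Nonnegativity of every continuation is needed to move `ENNReal.ofReal` through the sum over the
  -- random draws.
  have hmean : ∀ (q : Prog V α) (M' : Mem V), 0 ≤ q.mean N M' F := fun q M' => by
    rw [← Prog.mean_const N q M' 0]
    refine Prog.mean_le_mean N ?_
    induction q generalizing M' with
    | done a => exact hF _ _
    | exec o k ih =>
      cases o with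
      | random m => exact ⟨fun _ => ih _ _, fun j _ => ih _ _⟩
      | _ => exact ih _ _
  induction p generalizing M with
  | done a =>
    rw [Prog.run, PMF.toOuterMeasure_pure_apply]
    split_ifs with h
    · simpa [Prog.mean] using hS _ _ h
    · simp
  | exec o k ih =>
    cases o with
    | random m =>
      rcases Nat.eq_zero_or_pos m with rfl | hm
      · rw [Prog.run_random_zero N k M, PMF.toOuterMeasure_map_apply]
        exact ih _ _
      · have : Nonempty (Fin m) := ⟨⟨0, hm⟩⟩
        rw [Prog.run_random N m k M hm, PMF.toOuterMeasure_bind_apply, tsum_fintype]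
        have hmR : (0 : ℝ) < m := by exact_mod_cast hm
        have : (Prog.exec (.random m) k).mean N M F
            = ∑ j : Fin m, (m : ℝ)⁻¹ * (k (j : ℕ)).mean N M F := by
          change Instr.mean N _ M _ = _
          simp only [Instr.mean, hm, if_true]
          rw [Finset.sum_range, ← Finset.mul_sum]
          field_simp
        rw [this, ENNReal.ofReal_sum_of_nonneg fun j _ => mul_nonneg (by positivity) (hmean _ _)]
        gcongr with j
        rw [PMF.toOuterMeasure_map_apply, ENNReal.ofReal_mul (by positivity),
          ENNReal.ofReal_inv_of_pos hmR, ENNReal.ofReal_natCast, PMF.uniformOfFintype_apply,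
          Fintype.card_fin]
        gcongr
        exact ih _ _
    | _ =>
      simp only [Prog.run, Instr.sem]
      erw [PMF.pure_bind, PMF.toOuterMeasure_map_apply]
      exact ih _ _

end Logic

/-! ### Evaluation rules for single instructions. -/

section Primitives

variable {V : Type} [Fintype V] {G : SimpleGraph V} [DecidableRel G.Adj]
variable (N : AdjLists G) {α : Type} (M : Mem V)

@[simp] theorem holds_pure (a : α) (Q) :
    (pure a : Prog V α).Holds N M Q ↔ Q a M 0 := Iff.rfl
@[simp] theorem holds_degreeQ (u : V) (Q) :
    (degreeQ u).Holds N M Q ↔ Q (G.degree u) M 1 := Iff.rfl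
@[simp] theorem holds_neighborQ (u : V) (i : ℕ) (Q) :
    (neighborQ u i).Holds N M Q ↔ Q (N.nbr u i) M 1 := Iff.rfl
@[simp] theorem holds_random (k : ℕ) (Q) :
    (random k).Holds N M Q ↔ (k = 0 → Q 0 M 1) ∧ ∀ j < k, Q j M 1 := Iff.rfl
@[simp] theorem holds_add (x y : ℝ) (Q) : (add x y).Holds N M Q ↔ Q (x + y) M 1 := Iff.rfl
@[simp] theorem holds_mul (x y : ℝ) (Q) : (mul x y).Holds N M Q ↔ Q (x * y) M 1 := Iff.rfl
@[simp] theorem holds_div (x y : ℝ) (Q) : (div x y).Holds N M Q ↔ Q (x / y) M 1 := Iff.rfl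
@[simp] theorem holds_sqrtOp (x : ℝ) (Q) : (sqrtOp x).Holds N M Q ↔ Q √x M 1 := Iff.rfl
@[simp] theorem holds_logOp (x : ℝ) (Q) : (logOp x).Holds N M Q ↔ Q (Real.log x) M 1 := Iff.rfl
@[simp] theorem holds_ceilOp (x : ℝ) (Q) : (ceilOp x).Holds N M Q ↔ Q ⌈x⌉₊ M 1 := Iff.rfl
@[simp] theorem holds_less (x y : ℝ) (Q) :
    (less x y).Holds N M Q ↔ Q (decide (x < y)) M 1 := Iff.rfl
@[simp] theorem holds_load (a : Cell V) (Q) : (load a).Holds N M Q ↔ Q (M a) M 1 := Iff.rfl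
@[simp] theorem holds_store (a : Cell V) (x : ℝ) (Q) :
    (store a x).Holds N M Q ↔ Q () (M.set a x) 1 := Iff.rfl
@[simp] theorem holds_tick (Q) : (tick : Prog V Unit).Holds N M Q ↔ Q () M 1 := Iff.rfl

@[simp] theorem mean_pure (a : α) (F) : (pure a : Prog V α).mean N M F = F a M := rfl
@[simp] theorem mean_degreeQ (u : V) (F) : (degreeQ u).mean N M F = F (G.degree u) M := rfl
@[simp] theorem mean_neighborQ (u : V) (i : ℕ) (F) :
    (neighborQ u i).mean N M F = F (N.nbr u i) M := rfl
@[simp] theorem mean_add (x y : ℝ) (F) : (add x y).mean N M F = F (x + y) M := rfl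
@[simp] theorem mean_mul (x y : ℝ) (F) : (mul x y).mean N M F = F (x * y) M := rfl
@[simp] theorem mean_div (x y : ℝ) (F) : (div x y).mean N M F = F (x / y) M := rfl
@[simp] theorem mean_sqrtOp (x : ℝ) (F) : (sqrtOp x).mean N M F = F √x M := rfl
@[simp] theorem mean_logOp (x : ℝ) (F) : (logOp x).mean N M F = F (Real.log x) M := rfl
@[simp] theorem mean_ceilOp (x : ℝ) (F) : (ceilOp x).mean N M F = F ⌈x⌉₊ M := rfl
@[simp] theorem mean_less (x y : ℝ) (F) : (less x y).mean N M F = F (decide (x < y)) M := rfl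
@[simp] theorem mean_load (a : Cell V) (F) : (load a).mean N M F = F (M a) M := rfl
@[simp] theorem mean_store (a : Cell V) (x : ℝ) (F) :
    (store a x).mean N M F = F () (M.set a x) := rfl
@[simp] theorem mean_tick (F) : (tick : Prog V Unit).mean N M F = F () M := rfl

theorem mean_random {k : ℕ} (hk : 0 < k) (F) :
    (random k).mean N M F = (∑ j ∈ Finset.range k, F j M) / k := if_pos hk

end Primitives

/-! ### Effect and cost of the pushes on one level. -/

section Push

variable {V : Type} [Fintype V] [DecidableEq V] {G : SimpleGraph V} [DecidableRel G.Adj]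
variable (N : AdjLists G)

/-- The memory `M` with the residuals `R` and the coarse approximation `q` at the source `b`. -/
def Mem.withSource (M : Mem V) (b : Bool) (R : ℕ → V → ℝ) (q : V → ℝ) : Mem V
  | .res b' i v => if b' = b then R i v else M (.res b' i v)
  | .est b' v => if b' = b then q v else M (.est b' v)
  | .out b' c => M (.out b' c)

@[simp] theorem Mem.withSource_res (M : Mem V) (b R q i) (v : V) :
    M.withSource b R q (.res b i v) = R i v := by simp [withSource]

@[simp] theorem Mem.withSource_est (M : Mem V) (b R q) (v : V) :
    M.withSource b R q (.est b v) = q v := by simp [withSource]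

@[simp] theorem Mem.withSource_set_res (M : Mem V) (b R q i) (v : V) (x : ℝ) :
    (M.withSource b R q).set (.res b i v) x =
      M.withSource b (Function.update R i (Function.update (R i) v x)) q := by
  funext a
  by_cases ha : a = .res b i v
  · subst ha; simp [Mem.set_self]
  · rw [Mem.set_of_ne _ ha]
    cases a with
    | res b' i' v' =>
      simp only [withSource]
      split_ifs with hb
      · subst hb
        by_cases hi : i' = i
        · subst hi
          have : v' ≠ v := by rintro rfl; exact ha rfl
          simp [this]
        · simp [hi]
      · rfl
    | _ => rfl

@[simp] theorem Mem.withSource_set_est (M : Mem V) (b R q) (v : V) (x : ℝ) :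
    (M.withSource b R q).set (.est b v) x = M.withSource b R (Function.update q v x) := by
  funext a
  by_cases ha : a = .est b v
  · subst ha; simp [Mem.set_self]
  · rw [Mem.set_of_ne _ ha]
    cases a with
    | est b' v' =>
      simp only [withSource]
      split_ifs with hb
      · subst hb
        have : v' ≠ v := by rintro rfl; exact ha rfl
        simp [this]
      · rfl
    | _ => rfl

variable (G) in
/-- `Q` lists, without repetition, the vertices at which `f` exceeds its threshold. -/
def IsWorklist (ρ : ℝ) (f : V → ℝ) (Q : List V) : Prop :=
  Q.Nodup ∧ ∀ v, v ∈ Q ↔ ρ * G.degree v < f v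

/-- Since `x ≥ 0`, residuals only grow, so a vertex crosses its threshold at most once. Inserting it
exactly at the crossing keeps the worklist complete and free of repetitions. -/
theorem holds_addResidual (b : Bool) (i : ℕ) (ρ : ℝ) (v : V) (x : ℝ) (Q : List V) (M : Mem V)
    (R : ℕ → V → ℝ) (q : V → ℝ) (hx : 0 ≤ x) (hQ : IsWorklist G ρ (R i) Q) :
    (addResidual b i ρ v x Q).Holds N (M.withSource b R q) fun Q' M' n =>
      M' = M.withSource b (Function.update R i (R i + Pi.single v x)) q ∧
      IsWorklist G ρ (R i + Pi.single v x) Q' ∧ n ≤ 8 := by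
  have hupd : Function.update (R i) v (R i v + x) = R i + Pi.single v x := by
    funext w
    by_cases hw : w = v
    · subst hw; simp
    · simp [hw]
  simp only [addResidual, Prog.holds_bind, holds_load, holds_add, holds_store, holds_degreeQ,
    holds_mul, holds_less, Mem.withSource_res, Mem.withSource_set_res, hupd]
  split_ifs with h
  · simp only [Bool.and_eq_true, decide_eq_true_eq, Bool.not_eq_true', decide_eq_false_iff_not]
      at h
    simp only [Prog.holds_bind, holds_tick, holds_pure]
    refine ⟨trivial, ⟨List.nodup_cons.2 ⟨fun hv => h.2 ((hQ.2 v).1 hv), hQ.1⟩, fun w => ?_⟩,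
      by omega⟩
    by_cases hw : w = v
    · subst hw; simpa using h.1
    · simp [hw, hQ.2 w]
  · simp only [Bool.and_eq_true, decide_eq_true_eq, Bool.not_eq_true', decide_eq_false_iff_not,
      not_and, not_not] at h
    simp only [holds_pure]
    refine ⟨trivial, ⟨hQ.1, fun w => ?_⟩, by omega⟩
    by_cases hw : w = v
    · subst hw
      simp only [hQ.2 w, Pi.add_apply, Pi.single_eq_same]
      exact ⟨fun h' => by linarith, h⟩
    · simp [hw, hQ.2 w]

theorem holds_pushNeighbors (b : Bool) (i : ℕ) (ρ : ℝ) (w : V) (x : ℝ) (hx : 0 ≤ x) (M : Mem V)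
    (q : V → ℝ) (m : ℕ) (Q : List V) (R : ℕ → V → ℝ) (hQ : IsWorklist G ρ (R i) Q) :
    (pushNeighbors b i ρ w x m Q).Holds N (M.withSource b R q) fun Q' M' n =>
      M' = M.withSource b
        (Function.update R i (R i + ∑ j ∈ Finset.range m, Pi.single (N.nbr w j) x)) q ∧
      IsWorklist G ρ (R i + ∑ j ∈ Finset.range m, Pi.single (N.nbr w j) x) Q' ∧ n ≤ 10 * m := by
  induction m generalizing Q R with
  | zero => simpa [pushNeighbors] using hQ
  | succ m ih =>
    simp only [pushNeighbors, Prog.holds_bind, holds_tick, holds_neighborQ]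
    refine (holds_addResidual N b i ρ (N.nbr w m) x Q M R q hx hQ).mono N ?_
    rintro Q₁ M₁ n₁ ⟨rfl, hQ₁, hn₁⟩
    refine (ih Q₁ _ (by simpa using hQ₁)).mono N ?_
    rintro Q₂ M₂ n₂ ⟨rfl, hQ₂, hn₂⟩
    simp only [Function.update_self, Function.update_idem] at hQ₂ ⊢
    rw [add_assoc, add_comm (Pi.single _ _), ← Finset.sum_range_succ] at hQ₂ ⊢
    exact ⟨rfl, hQ₂, by omega⟩

variable (G) in
/-- The mass received by the vertices when a mass `x` at `w` makes a step of the lazy walk. -/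
def spread (w : V) (x : ℝ) (v : V) : ℝ :=
  (if v = w then x / 2 else 0) + if G.Adj w v then x / 2 / G.degree w else 0

/-- An adjacency list is a bijection onto the neighbors, so its order drops out of the resulting
residuals. -/
theorem AdjLists.sum_single_nbr (w : V) (x : ℝ) :
    ∑ j ∈ Finset.range (G.degree w), Pi.single (N.nbr w j) x =
      fun v => if G.Adj w v then x else 0 := by
  funext v
  rw [Finset.sum_apply, Finset.sum_range]
  have h : ∀ j : Fin (G.degree w), N.nbr w j = (N w j : V) := fun j => by
    simp [AdjLists.nbr]
  simp only [h]
  rw [Fintype.sum_equiv (N w) _ (fun y => (Pi.single (y : V) x : V → ℝ) v) fun _ => rfl]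
  simp only [Pi.single_apply]
  split_ifs with hv
  · rw [Finset.sum_eq_single ⟨v, hv⟩]
    · simp
    · rintro ⟨y, hy⟩ - hne
      rw [if_neg]
      rintro rfl
      exact hne rfl
    · simp
  · refine Finset.sum_eq_zero fun y _ => if_neg ?_
    rintro rfl
    exact hv y.2

theorem holds_pushVertex (b : Bool) (i : ℕ) (ρ : ℝ) (w : V) (Q : List V) (M : Mem V)
    (R : ℕ → V → ℝ) (q : V → ℝ) (hx : 0 ≤ R i w) (hQ : IsWorklist G ρ (R (i + 1)) Q) :
    (pushVertex b i ρ w Q).Holds N (M.withSource b R q) fun Q' M' n =>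
      M' = M.withSource b
        (Function.update (Function.update R (i + 1) (R (i + 1) + spread G w (R i w))) i
          (Function.update (R i) w 0)) (q + Pi.single w (R i w)) ∧
      IsWorklist G ρ (R (i + 1) + spread G w (R i w)) Q' ∧ n ≤ 16 + 10 * G.degree w := by
  have hupd : Function.update q w (q w + R i w) = q + Pi.single w (R i w) := by
    funext v
    by_cases hv : v = w
    · subst hv; simp
    · simp [hv]
  simp only [pushVertex, Prog.holds_bind, holds_load, holds_add, holds_store, holds_degreeQ,
    holds_div, Mem.withSource_res, Mem.withSource_est, Mem.withSource_set_est, hupd]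
  refine (holds_pushNeighbors N b (i + 1) ρ w (R i w / 2 / G.degree w) (by positivity) M _
    (G.degree w) Q R hQ).mono N ?_
  rintro Q₁ M₁ n₁ ⟨rfl, hQ₁, hn₁⟩
  refine (holds_addResidual N b (i + 1) ρ w (R i w / 2) Q₁ M _ _ (by positivity)
    (by simpa using hQ₁)).mono N ?_
  rintro Q₂ M₂ n₂ ⟨rfl, hQ₂, hn₂⟩
  have hs : R (i + 1) + (fun v => if G.Adj w v then R i w / 2 / G.degree w else 0) +
      Pi.single w (R i w / 2) = R (i + 1) + spread G w (R i w) := by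
    funext v
    simp only [Pi.add_apply, Pi.single_apply, spread]
    ring
  simp only [Function.update_self, Function.update_idem, AdjLists.sum_single_nbr, hs] at hQ₂ ⊢
  simp only [Mem.withSource_set_res, holds_pure]
  exact ⟨by simp, hQ₂, by omega⟩

/-- Pushes on one level do not interfere: each changes level `i` only at its own vertex, and the
vertices are distinct. Every vertex thus spreads the residual it had at the start, and the pushes
amount to one simultaneous update. -/
theorem holds_pushLevel (b : Bool) (i : ℕ) (ρ : ℝ) (M : Mem V) (W : List V) (hW : W.Nodup)
    (Q : List V) (R : ℕ → V → ℝ) (q : V → ℝ) (hR : ∀ w ∈ W, 0 ≤ R i w)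
    (hQ : IsWorklist G ρ (R (i + 1)) Q) :
    (pushLevel b i ρ W Q).Holds N (M.withSource b R q) fun Q' M' n =>
      M' = M.withSource b
        (Function.update
          (Function.update R (i + 1) (R (i + 1) + ∑ w ∈ W.toFinset, spread G w (R i w))) i
          (fun w => if w ∈ W then 0 else R i w)) (q + ∑ w ∈ W.toFinset, Pi.single w (R i w)) ∧
      IsWorklist G ρ (R (i + 1) + ∑ w ∈ W.toFinset, spread G w (R i w)) Q' ∧
      n ≤ ∑ w ∈ W.toFinset, (17 + 10 * G.degree w) := by
  induction W generalizing Q R q with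
  | nil => simpa [pushLevel] using hQ
  | cons w W ih =>
    obtain ⟨hwW, hW⟩ := List.nodup_cons.1 hW
    have hwW' : w ∉ W.toFinset := by simpa using hwW
    simp only [pushLevel, Prog.holds_bind, holds_tick]
    refine (holds_pushVertex N b i ρ w Q M R q (hR w (by simp)) hQ).mono N ?_
    rintro Q₁ M₁ n₁ ⟨rfl, hQ₁, hn₁⟩
    have hne : ∀ v ∈ W, v ≠ w := by rintro v hv rfl; exact hwW hv
    refine (ih hW Q₁ _ _ ?_ (by simpa using hQ₁)).mono N ?_
    · intro v hv
      simpa [hne v hv] using hR v (by simp [hv])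
    rintro Q₂ M₂ n₂ ⟨rfl, hQ₂, hn₂⟩
    have hsum : ∀ g : V → ℝ → V → ℝ,
        ∑ v ∈ W.toFinset, g v (Function.update (R i) w 0 v) =
        ∑ v ∈ W.toFinset, g v (R i v) := fun g => by
      refine Finset.sum_congr rfl fun v hv => ?_
      rw [Function.update_of_ne (hne v (by simpa using hv))]
    have hi : i + 1 ≠ i := by omega
    simp only [Function.update_self, Function.update_of_ne hi, hsum] at hQ₂ ⊢
    rw [List.toFinset_cons, Finset.sum_insert hwW', Finset.sum_insert hwW',
      Finset.sum_insert hwW', ← add_assoc, ← add_assoc]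
    refine ⟨?_, hQ₂, by omega⟩
    congr 1
    funext j v
    by_cases hj : j = i
    · subst hj
      by_cases hv : v = w
      · subst hv; simp
      · simp [hv]
    · by_cases hj' : j = i + 1
      · subst hj'; simp
      · simp [hj, hj']

end Push

/-! ### The deterministic stage as a recursion on mass distributions. -/

section Levels

variable {V : Type} [Fintype V] [DecidableEq V] (G : SimpleGraph V) [DecidableRel G.Adj]

/-- The part of the mass `f` that exceeds its threshold and is pushed. -/
def pushed (ρ : ℝ) (f : V → ℝ) (v : V) : ℝ := if ρ * G.degree v < f v then f v else 0

/-- The mass distribution obtained from `f` by one step of the lazy walk. -/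
def forward (f : V → ℝ) : V → ℝ := ∑ w, spread G w (f w)

/-- The residual of level `i` of the deterministic search from `u`, before it is pushed. -/
def levelMass (ρ : ℝ) (u : V) : ℕ → V → ℝ
  | 0 => Pi.single u (1 / 2)
  | i + 1 => forward G (pushed G ρ (levelMass ρ u i))

/-- The residual of level `i` that remains after the deterministic search from `u`. -/
def leftover (ρ : ℝ) (u : V) (i : ℕ) (v : V) : ℝ :=
  levelMass G ρ u i v - pushed G ρ (levelMass G ρ u i) v

/-- The residuals when the levels below `i` have been processed. -/
def residualsAt (ρ : ℝ) (u : V) (i j : ℕ) : V → ℝ :=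
  if j < i then leftover G ρ u j else if j = i then levelMass G ρ u j else 0

variable {G}

theorem pushed_nonneg {ρ : ℝ} {f : V → ℝ} (hf : ∀ v, 0 ≤ f v) (v : V) : 0 ≤ pushed G ρ f v := by
  unfold pushed
  split_ifs <;> simp [hf]

theorem pushed_le {ρ : ℝ} {f : V → ℝ} (hf : ∀ v, 0 ≤ f v) (v : V) : pushed G ρ f v ≤ f v := by
  unfold pushed
  split_ifs <;> simp [hf]

theorem spread_zero (w : V) : spread G w 0 = 0 := by
  funext v
  simp [spread]

theorem spread_nonneg (w : V) {x : ℝ} (hx : 0 ≤ x) (v : V) : 0 ≤ spread G w x v := by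
  unfold spread
  split_ifs <;> positivity

theorem levelMass_nonneg (ρ : ℝ) (u : V) (i : ℕ) (v : V) : 0 ≤ levelMass G ρ u i v := by
  induction i generalizing v with
  | zero =>
    simp only [levelMass, Pi.single_apply]
    split_ifs <;> norm_num
  | succ i ih =>
    simp only [levelMass, forward, Finset.sum_apply]
    exact Finset.sum_nonneg fun w _ => spread_nonneg w (pushed_nonneg ih w) v

theorem leftover_nonneg (ρ : ℝ) (u : V) (i : ℕ) (v : V) : 0 ≤ leftover G ρ u i v :=
  sub_nonneg.2 (pushed_le (levelMass_nonneg ρ u i) v)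

theorem leftover_le {ρ : ℝ} (hρ : 0 ≤ ρ) (u : V) (i : ℕ) (v : V) :
    leftover G ρ u i v ≤ ρ * G.degree v := by
  unfold leftover pushed
  split_ifs with h
  · simp only [sub_self]; positivity
  · linarith

theorem sum_spread (hG : ∀ v, 0 < G.degree v) (w : V) (x : ℝ) : ∑ v, spread G w x v = x := by
  have hd : (G.degree w : ℝ) ≠ 0 := by exact_mod_cast (hG w).ne'
  simp only [spread, Finset.sum_add_distrib, Finset.sum_ite_eq', Finset.mem_univ, if_true]
  rw [← Finset.sum_filter, Finset.sum_const, nsmul_eq_mul, ← SimpleGraph.neighborFinset_eq_filter,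
    SimpleGraph.card_neighborFinset_eq_degree]
  field_simp
  ring

/-- A lazy step preserves mass and keeping only the pushed part can only lose some. This is the
budget that pays for the pushes. -/
theorem sum_levelMass_le (hG : ∀ v, 0 < G.degree v) (ρ : ℝ) (u : V) (i : ℕ) :
    ∑ v, levelMass G ρ u i v ≤ 1 / 2 := by
  induction i with
  | zero => simp [levelMass]
  | succ i ih =>
    simp only [levelMass, forward, Finset.sum_apply]
    rw [Finset.sum_comm]
    simp only [sum_spread hG]
    exact (Finset.sum_le_sum fun v _ => pushed_le (levelMass_nonneg ρ u i) v).trans ih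

variable (N : AdjLists G)

theorem holds_pushLevels (hG : ∀ v, 0 < G.degree v) (b : Bool) {ρ : ℝ} (hρ : 0 < ρ) (u : V)
    (M : Mem V) (m i : ℕ) (W : List V) (hW : IsWorklist G ρ (levelMass G ρ u i) W) :
    (pushLevels b ρ i m W).Holds N
      (M.withSource b (residualsAt G ρ u i)
        (∑ k ∈ Finset.range i, pushed G ρ (levelMass G ρ u k))) fun _ M' n =>
      M' = M.withSource b (residualsAt G ρ u (i + m))
        (∑ k ∈ Finset.range (i + m), pushed G ρ (levelMass G ρ u k)) ∧
      (n : ℝ) ≤ m * (1 + 14 / ρ) := by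
  induction m generalizing i W with
  | zero => simp [pushLevels]
  | succ m ih =>
    have hRi : residualsAt G ρ u i i = levelMass G ρ u i := by simp [residualsAt]
    have hRi' : residualsAt G ρ u i (i + 1) = 0 := by simp [residualsAt]
    have hmem : ∀ w, w ∈ W.toFinset ↔ ρ * G.degree w < levelMass G ρ u i w := fun w => by
      rw [List.mem_toFinset, hW.2]
    have hfwd : ∑ w ∈ W.toFinset, spread G w (levelMass G ρ u i w) = levelMass G ρ u (i + 1) := by
      simp only [levelMass, forward]
      refine Finset.sum_subset_zero_on_sdiff (Finset.subset_univ _) (fun w hw => ?_)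
        fun w hw => ?_
      · have := (not_congr (hmem w)).1 (by simpa using hw)
        rw [pushed, if_neg this, spread_zero]
      · rw [pushed, if_pos ((hmem w).1 hw)]
    have hest : ∑ w ∈ W.toFinset, Pi.single w (levelMass G ρ u i w) =
        pushed G ρ (levelMass G ρ u i) := by
      funext v
      simp only [Finset.sum_apply, Pi.single_apply, Finset.sum_ite_eq, hmem, pushed]
    -- A pushed vertex has mass above `ρ d_w`, so its cost `17 + 10 d_w ≤ 27 d_w` is at most `27 /
    -- ρ` times its mass. The total mass is at most `1/2`, and `27 / 2 ≤ 14`.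
    have htime : ((∑ w ∈ W.toFinset, (17 + 10 * G.degree w) : ℕ) : ℝ) ≤ 14 / ρ := by
      rw [le_div_iff₀ hρ]
      push_cast
      rw [Finset.sum_mul]
      calc ∑ w ∈ W.toFinset, (17 + 10 * (G.degree w : ℝ)) * ρ
          ≤ ∑ w ∈ W.toFinset, 27 * levelMass G ρ u i w := by
            refine Finset.sum_le_sum fun w hw => ?_
            have h1 : (1 : ℝ) ≤ G.degree w := by exact_mod_cast hG w
            have h2 := (hmem w).1 hw
            nlinarith
        _ ≤ ∑ w, 27 * levelMass G ρ u i w :=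
            Finset.sum_le_univ_sum_of_nonneg fun w => by
              have := levelMass_nonneg (G := G) ρ u i w
              positivity
        _ ≤ 14 := by
            rw [← Finset.mul_sum]
            have := sum_levelMass_le hG ρ u i
            linarith
    simp only [pushLevels, Prog.holds_bind, holds_tick]
    refine (holds_pushLevel N b i ρ M W hW.1 [] _ _ ?_ ?_).mono N ?_
    · intro w _
      rw [hRi]
      exact levelMass_nonneg ρ u i w
    · rw [hRi']
      exact ⟨List.nodup_nil, fun v => by simp; positivity⟩
    rintro Q M₁ n₁ ⟨rfl, hQ, hn₁⟩
    rw [hRi, hRi', hfwd, zero_add] at hQ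
    have hstate : Function.update
        (Function.update (residualsAt G ρ u i) (i + 1) (residualsAt G ρ u i (i + 1) +
          ∑ w ∈ W.toFinset, spread G w (residualsAt G ρ u i i w))) i
        (fun w => if w ∈ W then 0 else residualsAt G ρ u i i w) = residualsAt G ρ u (i + 1) := by
      rw [hRi, hRi', hfwd, zero_add]
      funext j v
      rcases lt_trichotomy j i with hj | rfl | hj
      · simp [residualsAt, hj, hj.ne, show j < i + 1 by omega, show j ≠ i + 1 by omega]
      · simp only [Function.update_self, residualsAt, Nat.lt_succ_self, if_true, leftover,
          pushed, hW.2]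
        split_ifs <;> simp
      · by_cases hj' : j = i + 1
        · subst hj'; simp [residualsAt]
        · simp [residualsAt, hj', hj.ne', show ¬ j < i by omega, show ¬ j < i + 1 by omega]
    rw [hstate, hRi, hest, ← Finset.sum_range_succ]
    refine (ih (i + 1) Q hQ).mono N ?_
    rintro _ M₂ n₂ ⟨rfl, hn₂⟩
    refine ⟨by rw [add_right_comm, add_assoc], ?_⟩
    have : (n₁ : ℝ) ≤ 14 / ρ := le_trans (by exact_mod_cast hn₁) htime
    push_cast
    linarith

/-- The deterministic search from `u`, started with empty tables at the source `b`. -/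
theorem holds_cgd (hG : ∀ v, 0 < G.degree v) (b : Bool) (u : V) (L : ℕ) {rmax : ℝ}
    (hρ : 0 < rmax / (L * L)) (M : Mem V) :
    (cgd b u L rmax).Holds N (M.withSource b 0 0) fun _ M' n =>
      M' = M.withSource b (residualsAt G (rmax / (L * L)) u (L + 1))
        (∑ k ∈ Finset.range (L + 1), pushed G (rmax / (L * L))
          (levelMass G (rmax / (L * L)) u k)) ∧
      (n : ℝ) ≤ 10 + (L + 1) * (1 + 14 / (rmax / (L * L))) := by
  simp only [cgd, Prog.holds_bind, holds_mul, holds_div]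
  refine (holds_addResidual N b 0 _ u (1 / 2) [] M 0 0 (by norm_num)
    ⟨List.nodup_nil, fun v => by simp; positivity⟩).mono N ?_
  rintro W M₁ n₁ ⟨rfl, hW, hn₁⟩
  have h0 : Function.update (0 : ℕ → V → ℝ) 0 ((0 : ℕ → V → ℝ) 0 + Pi.single u (1 / 2)) =
      residualsAt G (rmax / (L * L)) u 0 := by
    funext j v
    cases j <;> simp [residualsAt, levelMass]
  rw [h0]
  have := holds_pushLevels N hG b hρ u M (L + 1) 0 W (by simpa [levelMass] using hW)
  rw [zero_add, Finset.range_zero, Finset.sum_empty] at this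
  refine this.mono N ?_
  rintro _ M₂ n₂ ⟨rfl, hn₂⟩
  refine ⟨rfl, ?_⟩
  have : (n₁ : ℝ) ≤ 8 := by exact_mod_cast hn₁
  push_cast at hn₂ ⊢
  linarith

end Levels

/-! ### Random walks on the machine: cost, expectation, and generating function. -/

section Walk

variable {V : Type} [Fintype V] [DecidableEq V] (G : SimpleGraph V) [DecidableRel G.Adj]

/-- The expectation of `g` after one step of the lazy random walk. -/
def backward (g : V → ℝ) (w : V) : ℝ :=
  g w / 2 + (∑ v ∈ G.neighborFinset w, g v) / (2 * G.degree w)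

/-- The expectation of `Φ (∑_{k ≤ m} g (m - k) w_k)` along a lazy random walk `w_0, …, w_m`
from `w`. -/
def pathMean (g : ℕ → V → ℝ) : ℕ → V → (ℝ → ℝ) → ℝ
  | 0, w, Φ => Φ (g 0 w)
  | m + 1, w, Φ => backward G (fun w' => pathMean g m w' fun y => Φ (g (m + 1) w + y)) w

/-- The increment of an estimate by a walk at `w` with `m` steps to go, if the residuals
are `r`. -/
def increment (r : ℕ → V → ℝ) (scale : ℝ) (m : ℕ) (w : V) : ℝ :=
  scale * ((∑ i ∈ Finset.range (m + 1), r i w) / G.degree w)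

/-- The residuals stored in `M` are `r`. -/
def HasResiduals (M : Mem V) (r : Bool → ℕ → V → ℝ) : Prop :=
  ∀ b i w, M (.res b i w) = r b i w

theorem HasResiduals.set_out {M : Mem V} {r : Bool → ℕ → V → ℝ} (h : HasResiduals M r)
    (b c : Bool) (x : ℝ) : HasResiduals (M.set (.out b c) x) r := fun b' i w => by
  rw [Mem.set_of_ne _ (by simp), h]

variable {G}

theorem backward_const_mul (a : ℝ) (g : V → ℝ) (w : V) :
    backward G (fun v => a * g v) w = a * backward G g w := by
  simp only [backward, ← Finset.mul_sum]
  ring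

theorem backward_add (g h : V → ℝ) (w : V) :
    backward G (fun v => g v + h v) w = backward G g w + backward G h w := by
  simp only [backward, Finset.sum_add_distrib]
  ring

theorem backward_mono {g h : V → ℝ} (hgh : ∀ v, g v ≤ h v) (w : V) :
    backward G g w ≤ backward G h w := by
  unfold backward
  gcongr
  · exact hgh w
  · exact hgh _

theorem backward_const (hG : ∀ v, 0 < G.degree v) (a : ℝ) (w : V) :
    backward G (fun _ => a) w = a := by
  have : (G.degree w : ℝ) ≠ 0 := by exact_mod_cast (hG w).ne'
  simp only [backward, Finset.sum_const, SimpleGraph.card_neighborFinset_eq_degree, nsmul_eq_mul]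
  field_simp
  ring

theorem pathMean_const_mul (g : ℕ → V → ℝ) (a : ℝ) (m : ℕ) (w : V) (Φ : ℝ → ℝ) :
    pathMean G g m w (fun y => a * Φ y) = a * pathMean G g m w Φ := by
  induction m generalizing w Φ with
  | zero => rfl
  | succ m ih => simp only [pathMean, ih, backward_const_mul]

variable (N : AdjLists G)

theorem holds_residualSum (b : Bool) (w : V) (m : ℕ) (acc : ℝ) (M : Mem V) (Q) :
    (residualSum b w m acc).Holds N M Q ↔
      Q (acc + ∑ i ∈ Finset.range m, M (.res b i w)) M (3 * m) := by
  induction m generalizing acc Q with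
  | zero => simp [residualSum]
  | succ m ih =>
    simp only [residualSum, Prog.holds_bind, holds_tick, holds_load, holds_add, ih,
      Finset.sum_range_succ]
    rw [add_assoc, add_comm (M _), show 1 + (1 + (1 + 3 * m)) = 3 * (m + 1) by ring]

theorem mean_residualSum (b : Bool) (w : V) (m : ℕ) (acc : ℝ) (M : Mem V) (F) :
    (residualSum b w m acc).mean N M F =
      F (acc + ∑ i ∈ Finset.range m, M (.res b i w)) M := by
  induction m generalizing acc with
  | zero => simp [residualSum]
  | succ m ih =>
    simp only [residualSum, Prog.mean_bind, mean_tick, mean_load, mean_add, ih,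
      Finset.sum_range_succ]
    rw [add_assoc, add_comm (M _)]

theorem holds_updateEstimate (b c : Bool) (scale : ℝ) (w : V) (m : ℕ) {M : Mem V}
    {r : Bool → ℕ → V → ℝ} (hM : HasResiduals M r) (Q) :
    (updateEstimate b c scale w m).Holds N M Q ↔
      Q () (M.set (.out b c) (M (.out b c) + increment G (r b) scale m w)) (3 * m + 9) := by
  simp only [updateEstimate, Prog.holds_bind, holds_residualSum, holds_degreeQ, holds_div,
    holds_mul, holds_load, holds_add, holds_store, increment, zero_add, hM b]
  rw [show 3 * (m + 1) + (1 + (1 + (1 + (1 + (1 + 1))))) = 3 * m + 9 by ring]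

theorem mean_updateEstimate (b c : Bool) (scale : ℝ) (w : V) (m : ℕ) {M : Mem V}
    {r : Bool → ℕ → V → ℝ} (hM : HasResiduals M r) (F) :
    (updateEstimate b c scale w m).mean N M F =
      F () (M.set (.out b c) (M (.out b c) + increment G (r b) scale m w)) := by
  simp only [updateEstimate, Prog.mean_bind, mean_residualSum, mean_degreeQ, mean_div,
    mean_mul, mean_load, mean_add, mean_store, increment, zero_add, hM b]

theorem holds_lazyStep (w : V) (M : Mem V) {Q : V → Mem V → ℕ → Prop}
    (h : ∀ w' n, n ≤ 4 → Q w' M n) : (lazyStep w).Holds N M Q := by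
  simp only [lazyStep, Prog.holds_bind, holds_random]
  refine ⟨fun h2 => by omega, fun j _ => ?_⟩
  split_ifs
  · simp only [Prog.holds_bind, holds_degreeQ, holds_random, holds_neighborQ]
    exact ⟨fun _ => h _ _ (by norm_num), fun j _ => h _ _ (by norm_num)⟩
  · exact h _ _ (by norm_num)

theorem AdjLists.sum_nbr (w : V) (f : V → ℝ) :
    ∑ j ∈ Finset.range (G.degree w), f (N.nbr w j) = ∑ v ∈ G.neighborFinset w, f v := by
  rw [Finset.sum_range]
  have h : ∀ j : Fin (G.degree w), N.nbr w j = (N w j : V) := fun j => by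
    simp [AdjLists.nbr]
  simp only [h]
  rw [Fintype.sum_equiv (N w) _ (fun y => f y) fun _ => rfl]
  exact (Finset.sum_subtype _ (fun v => by simp) f).symm

theorem mean_lazyStep (w : V) (hw : 0 < G.degree w) (M : Mem V) (F : V → Mem V → ℝ) :
    (lazyStep w).mean N M F = backward G (fun w' => F w' M) w := by
  simp only [lazyStep, Prog.mean_bind]
  rw [mean_random N M (k := 2) (by norm_num), Finset.sum_range_succ, Finset.sum_range_one]
  simp only [if_true, one_ne_zero, if_false, Prog.mean_bind, mean_degreeQ, mean_random N M hw,
    mean_neighborQ, mean_pure, N.sum_nbr w fun v => F v M, backward]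
  have : (G.degree w : ℝ) ≠ 0 := by exact_mod_cast hw.ne'
  push_cast
  field_simp
  ring

/-- A walk writes only the two estimates with target flag `c`. A visit with `m` steps to go costs
one tick, two updates of cost `3 m + 9`, and at most `4` for the step. -/
theorem holds_walk (c : Bool) (scale : ℝ) (r : Bool → ℕ → V → ℝ) (m : ℕ) (w : V) (M : Mem V)
    (hM : HasResiduals M r) :
    (walk c scale m w).Holds N M fun _ M' n =>
      HasResiduals M' r ∧ (∀ b c', c' ≠ c → M' (.out b c') = M (.out b c')) ∧
        n ≤ (m + 1) * (6 * m + 23) := by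
  induction m generalizing w M with
  | zero =>
    simp only [walk, Prog.holds_bind, holds_tick, holds_updateEstimate N _ _ _ _ _ hM,
      holds_updateEstimate N _ _ _ _ _ (hM.set_out _ _ _)]
    refine ⟨(hM.set_out _ _ _).set_out _ _ _, fun b c' hc => ?_, by omega⟩
    rw [Mem.set_of_ne _ (by simp [hc]), Mem.set_of_ne _ (by simp [hc])]
  | succ m ih =>
    simp only [walk, Prog.holds_bind, holds_tick, holds_updateEstimate N _ _ _ _ _ hM,
      holds_updateEstimate N _ _ _ _ _ (hM.set_out _ _ _)]
    refine holds_lazyStep N w _ fun w' n hn => ?_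
    refine (ih w' _ ((hM.set_out _ _ _).set_out _ _ _)).mono N ?_
    rintro _ M' n' ⟨h1, h2, h3⟩
    refine ⟨h1, fun b c' hc => ?_, by nlinarith⟩
    rw [h2 b c' hc, Mem.set_of_ne _ (by simp [hc]), Mem.set_of_ne _ (by simp [hc])]

/-- The two updates at a visit go to different cells, so only the one with source flag `b` matters.
Since `pathMean` carries the function of the remaining sum, the value already accumulated is
absorbed into that function. -/
theorem mean_walk (hG : ∀ v, 0 < G.degree v) (b c : Bool) (scale : ℝ) (r : Bool → ℕ → V → ℝ)
    (m : ℕ) (w : V) (M : Mem V) (hM : HasResiduals M r) (Φ : ℝ → ℝ) :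
    (walk c scale m w).mean N M (fun _ M' => Φ (M' (.out b c))) =
      pathMean G (increment G (r b) scale) m w fun y => Φ (M (.out b c) + y) := by
  have hval : ∀ (k : ℕ) (w : V) (M : Mem V),
      ((M.set (.out false c) (M (.out false c) + increment G (r false) scale k w)).set
        (.out true c) ((M.set (.out false c) (M (.out false c) +
          increment G (r false) scale k w)) (.out true c) + increment G (r true) scale k w))
        (.out b c) = M (.out b c) + increment G (r b) scale k w := fun k w M => by
    cases b
    · rw [Mem.set_of_ne _ (by simp), Mem.set_self]
    · rw [Mem.set_self, Mem.set_of_ne _ (by simp)]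
  induction m generalizing w M with
  | zero =>
    simp only [walk, Prog.mean_bind, mean_tick, mean_updateEstimate N _ _ _ _ _ hM,
      mean_updateEstimate N _ _ _ _ _ (hM.set_out _ _ _), hval, pathMean]
  | succ m ih =>
    simp only [walk, Prog.mean_bind, mean_tick, mean_updateEstimate N _ _ _ _ _ hM,
      mean_updateEstimate N _ _ _ _ _ (hM.set_out _ _ _), mean_lazyStep N w (hG w), pathMean]
    congr 1
    funext w'
    rw [ih w' _ ((hM.set_out _ _ _).set_out _ _ _), hval]
    simp only [add_assoc]

theorem mean_walk_of_ne (b : Bool) {c c' : Bool} (hc : c' ≠ c) (scale : ℝ)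
    (r : Bool → ℕ → V → ℝ) (m : ℕ) (w : V) (M : Mem V) (hM : HasResiduals M r) (Φ : ℝ → ℝ) :
    (walk c scale m w).mean N M (fun _ M' => Φ (M' (.out b c'))) = Φ (M (.out b c')) := by
  rw [← Prog.mean_const N (walk c scale m w) M (Φ (M (.out b c')))]
  refine Prog.mean_congr N ((holds_walk N c scale r m w M hM).mono N ?_)
  rintro _ M' _ ⟨-, h, -⟩
  rw [h b c' hc]

theorem holds_sample (s t : V) (L : ℕ) (scaleS scaleT : ℝ) (r : Bool → ℕ → V → ℝ) (k : ℕ)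
    (M : Mem V) (hM : HasResiduals M r) :
    (sample s t L scaleS scaleT k).Holds N M fun _ _ n =>
      n ≤ k * (1 + 2 * ((L + 1) * (6 * L + 23))) := by
  induction k generalizing M with
  | zero => simp [sample]
  | succ k ih =>
    simp only [sample, Prog.holds_bind, holds_tick]
    refine (holds_walk N false scaleS r L s M hM).mono N ?_
    rintro _ M₁ n₁ ⟨h₁, -, hn₁⟩
    refine (holds_walk N true scaleT r L t M₁ h₁).mono N ?_
    rintro _ M₂ n₂ ⟨h₂, -, hn₂⟩
    refine (ih M₂ h₂).mono N ?_
    intro _ M₃ n₃ hn₃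
    rw [Nat.succ_mul]
    omega

/-- The moment generating function of an estimate after `k` rounds of sampling. -/
theorem mean_sample (hG : ∀ v, 0 < G.degree v) (b c : Bool) (s t : V) (L : ℕ)
    (scale : Bool → ℝ) (r : Bool → ℕ → V → ℝ) (θ : ℝ) (k : ℕ) (M : Mem V)
    (hM : HasResiduals M r) :
    (sample s t L (scale false) (scale true) k).mean N M
        (fun _ M' => Real.exp (θ * M' (.out b c))) =
      Real.exp (θ * M (.out b c)) *
        (pathMean G (increment G (r b) (scale c)) L (endpoint s t c)
          fun y => Real.exp (θ * y)) ^ k := by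
  set A := pathMean G (increment G (r b) (scale c)) L (endpoint s t c) fun y => Real.exp (θ * y)
    with hA
  have hmul : ∀ x : ℝ, pathMean G (increment G (r b) (scale c)) L (endpoint s t c)
      (fun y => Real.exp (θ * (x + y))) = Real.exp (θ * x) * A := fun x => by
    simp only [mul_add, Real.exp_add, pathMean_const_mul, hA]
  induction k generalizing M with
  | zero => simp [sample]
  | succ k ih =>
    simp only [sample, Prog.mean_bind, mean_tick]
    -- By induction the later rounds contribute the constant factor `A ^ k`, because a round leaves
    -- the residuals intact; this is where independence of the rounds enters.
    have h₂ : ∀ M₁, HasResiduals M₁ r →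
        (walk true (scale true) L t).mean N M₁ (fun _ M₂ =>
          (sample s t L (scale false) (scale true) k).mean N M₂
            fun _ M' => Real.exp (θ * M' (.out b c))) =
        (walk true (scale true) L t).mean N M₁ (fun _ M₂ => Real.exp (θ * M₂ (.out b c))) *
          A ^ k := fun M₁ h₁ => by
      rw [← Prog.mean_mul_const]
      refine Prog.mean_congr N ((holds_walk N true _ r L t M₁ h₁).mono N ?_)
      rintro _ M₂ _ ⟨h, -, -⟩
      exact ih M₂ h
    rw [Prog.mean_congr N ((holds_walk N false _ r L s M hM).mono N fun _ M₁ _ h => h₂ M₁ h.1),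
      Prog.mean_mul_const]
    -- Of the two walks in a round only the one from the target `c` changes the estimate. It
    -- supplies the last factor `A`, whether it runs first or second.
    cases c
    · rw [Prog.mean_congr N ((holds_walk N false _ r L s M hM).mono N fun _ M₁ _ h =>
        mean_walk_of_ne N b (by simp) (scale true) r L t M₁ h.1 fun y => Real.exp (θ * y)),
        mean_walk N hG b false (scale false) r L s M hM fun y => Real.exp (θ * y)]
      change pathMean G _ L (endpoint s t false) _ * A ^ k = _
      rw [hmul]
      ring
    · rw [Prog.mean_congr N ((holds_walk N false _ r L s M hM).mono N fun _ M₁ _ h =>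
        mean_walk N hG b true (scale true) r L t M₁ h.1 fun y => Real.exp (θ * y))]
      have := mean_walk_of_ne N b (show true ≠ false by simp) (scale false) r L s M hM
        fun x => pathMean G (increment G (r b) (scale true)) L t fun y => Real.exp (θ * (x + y))
      rw [this]
      change pathMean G _ L (endpoint s t true) _ * A ^ k = _
      rw [hmul]
      ring

end Walk

/-! ### Linearity and monotonicity of expectations along a walk. -/

section PathMean

variable {V : Type} [Fintype V] [DecidableEq V] {G : SimpleGraph V} [DecidableRel G.Adj]

theorem pathMean_smul (g : ℕ → V → ℝ) (a : ℝ) (m : ℕ) (w : V) (Φ : ℝ → ℝ) :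
    pathMean G (fun k v => a * g k v) m w Φ = pathMean G g m w fun y => Φ (a * y) := by
  induction m generalizing w Φ with
  | zero => rfl
  | succ m ih => simp only [pathMean, ih, mul_add]

theorem pathMean_congr {g g' : ℕ → V → ℝ} (m : ℕ) (h : ∀ k ≤ m, g k = g' k) (w : V)
    (Φ : ℝ → ℝ) : pathMean G g m w Φ = pathMean G g' m w Φ := by
  induction m generalizing w Φ with
  | zero => simp only [pathMean, h 0 le_rfl]
  | succ m ih => simp only [pathMean, ih fun k hk => h k (by omega), h (m + 1) le_rfl]

theorem pathMean_affine (hG : ∀ v, 0 < G.degree v) (g : ℕ → V → ℝ) (a b : ℝ) (m : ℕ) (w : V) :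
    pathMean G g m w (fun y => a + b * y) = a + b * pathMean G g m w fun y => y := by
  induction m generalizing w a b with
  | zero => rfl
  | succ m ih =>
    have h1 : ∀ w', pathMean G g m w' (fun y => a + b * (g (m + 1) w + y)) =
        (a + b * g (m + 1) w) + b * pathMean G g m w' fun y => y := fun w' => by
      rw [← ih]
      simp only [mul_add, add_assoc]
    have h2 : ∀ w', pathMean G g m w' (fun y => g (m + 1) w + y) =
        g (m + 1) w + 1 * pathMean G g m w' fun y => y := fun w' => by
      rw [← ih]
      simp only [one_mul]
    simp only [pathMean, h1, h2, backward_add, backward_const hG, backward_const_mul]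
    ring

/-- The accumulated sum is nonnegative and at most `∑ k ≤ m, (k + 1) ρ ≤ (m + 1)² ρ`, so functions
need to be compared only on that range. -/
theorem pathMean_mono {g : ℕ → V → ℝ} {ρ : ℝ} (hρ : 0 ≤ ρ) (hg : ∀ k w, 0 ≤ g k w)
    (hg' : ∀ (k : ℕ) w, g k w ≤ (k + 1) * ρ) (m : ℕ) (w : V) {Φ Ψ : ℝ → ℝ}
    (h : ∀ y, 0 ≤ y → y ≤ ((m : ℝ) + 1) ^ 2 * ρ → Φ y ≤ Ψ y) :
    pathMean G g m w Φ ≤ pathMean G g m w Ψ := by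
  induction m generalizing w Φ Ψ with
  | zero => exact h _ (hg _ _) (by simpa using hg' 0 w)
  | succ m ih =>
    refine backward_mono (fun w' => ih w' fun y hy hy' => h _ (add_nonneg (hg _ _) hy) ?_) w
    have := hg' (m + 1) w
    push_cast at this ⊢
    have h0 : 0 ≤ (m : ℝ) * ρ := by positivity
    nlinarith

end PathMean

/-! ### Reversibility, unbiasedness, and the generating function of one walk. -/

section Heat

variable {V : Type} [Fintype V] [DecidableEq V] (G : SimpleGraph V) [DecidableRel G.Adj]

/-- Half the density, with respect to the degrees, of the law of the lazy random walk from `u`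
after `j` steps. -/
def heat (u : V) : ℕ → V → ℝ
  | 0 => fun w => (Pi.single u (1 / 2) : V → ℝ) w / G.degree w
  | j + 1 => backward G (heat u j)

variable {G}

/-- Maximum principle: an average never exceeds a bound valid for all values, and the initial
density has maximum `1 / (2 d_u)`. -/
theorem heat_le (hG : ∀ v, 0 < G.degree v) (u : V) (j : ℕ) (w : V) :
    heat G u j w ≤ 1 / (2 * G.degree u) := by
  induction j generalizing w with
  | zero =>
    simp only [heat, Pi.single_apply]
    split_ifs with h
    · subst h; rw [div_div]
    · rw [zero_div]; positivity
  | succ j ih => exact (backward_mono ih w).trans_eq (backward_const hG _ w)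

/-- Reversibility of the lazy walk with respect to the degrees. It converts pushing from the source
into walking from the target. -/
theorem forward_div (hG : ∀ v, 0 < G.degree v) (f : V → ℝ) (v : V) :
    forward G f v / G.degree v = backward G (fun w => f w / G.degree w) v := by
  have hd : (G.degree v : ℝ) ≠ 0 := by exact_mod_cast (hG v).ne'
  simp only [forward, Finset.sum_apply, spread, Finset.sum_add_distrib, Finset.sum_ite_eq,
    Finset.mem_univ, if_true, backward, SimpleGraph.neighborFinset_eq_filter, Finset.sum_filter,
    SimpleGraph.adj_comm G v, add_div, Finset.sum_div]
  congr 1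
  · ring
  · refine Finset.sum_congr rfl fun w _ => ?_
    have hd' : (G.degree w : ℝ) ≠ 0 := by exact_mod_cast (hG w).ne'
    split_ifs
    · field_simp
    · simp

theorem lazyWalkMatrix_mulVec (x : V → ℝ) (v : V) :
    (lazyWalkMatrix G).mulVec x v =
      x v / 2 + (∑ w ∈ G.neighborFinset v, x w / G.degree w) / 2 := by
  rw [lazyWalkMatrix, Matrix.add_mulVec, Pi.add_apply, Matrix.smul_mulVec, Matrix.smul_mulVec,
    Matrix.one_mulVec, ← Matrix.mulVec_mulVec, Pi.smul_apply, Pi.smul_apply,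
    SimpleGraph.adjMatrix_mulVec_apply]
  simp only [Matrix.mulVec_diagonal, smul_eq_mul]
  rw [Finset.sum_congr rfl fun w _ => (inv_mul_eq_div (G.degree w : ℝ) (x w))]
  ring

theorem pL_eq (hG : ∀ v, 0 < G.degree v) (L : ℕ) (u v : V) :
    pL G L u v = G.degree v * ∑ j ∈ Finset.range (L + 1), heat G u j v := by
  have hd : ∀ v, (G.degree v : ℝ) ≠ 0 := fun v => by exact_mod_cast (hG v).ne'
  have key : ∀ (l : ℕ) v, ((lazyWalkMatrix G ^ l).mulVec (Pi.single u 1)) v =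
      2 * (G.degree v * heat G u l v) := by
    intro l
    induction l with
    | zero =>
      intro v
      have := hd v
      simp only [pow_zero, Matrix.one_mulVec, heat, Pi.single_apply]
      split_ifs
      · field_simp
      · simp
    | succ l ih =>
      intro v
      rw [pow_succ', ← Matrix.mulVec_mulVec, lazyWalkMatrix_mulVec, ih v]
      have : ∀ w ∈ G.neighborFinset v, ((lazyWalkMatrix G ^ l).mulVec (Pi.single u 1)) w /
          G.degree w = 2 * heat G u l w := fun w _ => by
        have := hd w
        rw [ih w]; field_simp
      rw [Finset.sum_congr rfl this, ← Finset.mul_sum, heat, backward]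
      have := hd v
      field_simp
  simp only [pL, key, ← Finset.mul_sum]
  ring

variable (G) in
/-- The increment of the estimate of `p_{L,u}` divided by the degree of the target, by a walk
at `w` with `m` steps to go. -/
def unitIncrement (ρ : ℝ) (u : V) : ℕ → V → ℝ := increment G (leftover G ρ u) 1

theorem unitIncrement_nonneg (ρ : ℝ) (u : V) (k : ℕ) (w : V) : 0 ≤ unitIncrement G ρ u k w := by
  rw [unitIncrement, increment, one_mul]
  exact div_nonneg (Finset.sum_nonneg fun i _ => leftover_nonneg ρ u i w) (Nat.cast_nonneg _)

theorem unitIncrement_le (hG : ∀ v, 0 < G.degree v) {ρ : ℝ} (hρ : 0 ≤ ρ) (u : V) (k : ℕ)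
    (w : V) : unitIncrement G ρ u k w ≤ (k + 1) * ρ := by
  have hd : (0 : ℝ) < G.degree w := by exact_mod_cast hG w
  rw [unitIncrement, increment, one_mul, div_le_iff₀ hd]
  refine (Finset.sum_le_sum fun i _ => leftover_le hρ u i w).trans_eq ?_
  simp [mul_assoc]

variable (G) in
/-- The part of the law of the walk from `u` at time `j` that the deterministic search misses, as
a density with respect to the degrees. -/
def missing (ρ : ℝ) (u : V) (j : ℕ) (w : V) : ℝ :=
  heat G u j w - pushed G ρ (levelMass G ρ u j) w / G.degree w

theorem missing_zero (ρ : ℝ) (u w : V) :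
    missing G ρ u 0 w = leftover G ρ u 0 w / G.degree w := by
  simp only [missing, leftover, heat, levelMass, sub_div]

/-- The full law and the pushed mass both advance by the same averaging. The deficit therefore
advances too, gaining at each level only what that level leaves behind. -/
theorem backward_missing (hG : ∀ v, 0 < G.degree v) (ρ : ℝ) (u : V) (j : ℕ) (w : V) :
    backward G (missing G ρ u j) w =
      missing G ρ u (j + 1) w - leftover G ρ u (j + 1) w / G.degree w := by
  have h : missing G ρ u j = fun w => heat G u j w +
      (-1) * (pushed G ρ (levelMass G ρ u j) w / G.degree w) := by
    funext w
    rw [missing]; ring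
  rw [h, backward_add, backward_const_mul, ← forward_div hG]
  simp only [missing, leftover, heat, levelMass]
  ring

/-- The pushed mass is nonnegative, so the deficit lies below the density of the full law, to which
the maximum principle applies. -/
theorem backward_missing_le (hG : ∀ v, 0 < G.degree v) (ρ : ℝ) (u : V) (j : ℕ) (w : V) :
    backward G (missing G ρ u j) w ≤ 1 / (2 * G.degree u) := by
  refine (backward_mono (fun v => ?_) w).trans (heat_le hG u (j + 1) w)
  exact sub_le_self _ (div_nonneg (pushed_nonneg (levelMass_nonneg ρ u j) v) (Nat.cast_nonneg _))

theorem backward_sum {ι : Type} (s : Finset ι) (f : ι → V → ℝ) (w : V) :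
    backward G (fun v => ∑ j ∈ s, f j v) w = ∑ j ∈ s, backward G (f j) w := by
  simp only [backward, Finset.sum_add_distrib, Finset.sum_div]
  rw [Finset.sum_comm]

/-- Unrolling the recursion of `backward_missing`, the deficit at time `j` collects the leftover of
level `i` after `j - i` backward steps. Summed over `j ≤ m`, a visit at step `k` sees exactly the
levels `i ≤ m - k`, which is the increment used by the walk. -/
theorem pathMean_unitIncrement (hG : ∀ v, 0 < G.degree v) (ρ : ℝ) (u : V) (m : ℕ) (w : V) :
    pathMean G (unitIncrement G ρ u) m w (fun y => y) =
      ∑ j ∈ Finset.range (m + 1), missing G ρ u j w := by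
  induction m generalizing w with
  | zero => simp [pathMean, unitIncrement, increment, missing_zero]
  | succ m ih =>
    have h := fun w' => pathMean_affine hG (unitIncrement G ρ u) (unitIncrement G ρ u (m + 1) w)
      1 m w'
    simp only [one_mul] at h
    simp only [pathMean, h, ih, backward_add, backward_const hG, backward_sum,
      backward_missing hG, Finset.sum_sub_distrib]
    rw [Finset.sum_range_succ' _ (m + 1), unitIncrement, increment, one_mul, Finset.sum_div,
      Finset.sum_range_succ' _ (m + 1), missing_zero]
    ring

theorem pL_div_sub (hG : ∀ v, 0 < G.degree v) (ρ : ℝ) (L : ℕ) (u v : V) :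
    pL G L u v / G.degree v - (∑ k ∈ Finset.range (L + 1), pushed G ρ (levelMass G ρ u k)) v /
        G.degree v = pathMean G (unitIncrement G ρ u) L v fun y => y := by
  have hd : (G.degree v : ℝ) ≠ 0 := by exact_mod_cast (hG v).ne'
  rw [pathMean_unitIncrement hG, pL_eq hG]
  simp only [missing, Finset.sum_sub_distrib, Finset.sum_apply, Finset.sum_div]
  field_simp

/-- A bound on the moment generating function of the contribution of a walk; only the steps after
the first contribute to the variance. -/
theorem pathMean_exp_le (hG : ∀ v, 0 < G.degree v) {ρ : ℝ} (hρ : 0 ≤ ρ) (u v : V) {L : ℕ}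
    (hL : 1 ≤ L) (x : ℝ) (hx : |x| * ((L : ℝ) ^ 2 * ρ) ≤ 1) :
    pathMean G (unitIncrement G ρ u) L v (fun y => Real.exp (x * y)) ≤
      Real.exp (x * pathMean G (unitIncrement G ρ u) L v (fun y => y) +
        x ^ 2 * ((L : ℝ) ^ 2 * ρ) * (L / (2 * G.degree u))) := by
  obtain ⟨l, rfl⟩ : ∃ l, L = l + 1 := ⟨L - 1, by omega⟩
  set g := unitIncrement G ρ u with hg
  set B : ℝ := ((l + 1 : ℕ) : ℝ) ^ 2 * ρ with hB
  have hB0 : 0 ≤ B := by positivity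
  -- The visit at time `0` is deterministic. Splitting it off leaves `L` visits, contributing at
  -- most `L² ρ` in total with mean at most `L / (2 d_u)`.
  set γ := g (l + 1) v with hγ
  set μ : ℝ := backward G (fun w => pathMean G g l w fun y => y) v with hμ
  have hμ' : pathMean G g (l + 1) v (fun y => y) = γ + μ := by
    have h := fun w' => pathMean_affine hG g γ 1 l w'
    simp only [one_mul] at h
    simp only [pathMean, ← hγ, h, backward_add, backward_const hG, hμ]
  have hμle : μ ≤ ((l + 1 : ℕ) : ℝ) / (2 * G.degree u) := by
    rw [hμ]
    simp only [hg, pathMean_unitIncrement hG, backward_sum]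
    refine (Finset.sum_le_sum fun j _ => backward_missing_le hG ρ u j v).trans_eq ?_
    rw [Finset.sum_const, Finset.card_range, nsmul_eq_mul]
    ring
  -- For `|x y| ≤ 1`, `exp (x y) ≤ 1 + x y + (x y)²`, and `y² ≤ B y` makes the majorant affine in
  -- `y`, so that only the mean of `y` is needed.
  have hpt : ∀ y : ℝ, 0 ≤ y → y ≤ ((l : ℝ) + 1) ^ 2 * ρ →
      Real.exp (x * (γ + y)) ≤
        Real.exp (x * γ) + (Real.exp (x * γ) * (x + x ^ 2 * B)) * y := by
    intro y hy0 hy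
    have hyB : y ≤ B := by rw [hB]; push_cast; exact hy
    have hxy : |x * y| ≤ 1 := by
      rw [abs_mul, abs_of_nonneg hy0]
      exact (mul_le_mul_of_nonneg_left hyB (abs_nonneg x)).trans hx
    have h1 := (abs_le.1 (Real.abs_exp_sub_one_sub_id_le hxy)).2
    have h2 : (x * y) ^ 2 ≤ x ^ 2 * B * y := by
      have : x ^ 2 * y * y ≤ x ^ 2 * y * B := by gcongr
      nlinarith
    have h3 : Real.exp (x * y) ≤ 1 + (x + x ^ 2 * B) * y := by linarith
    rw [mul_add, Real.exp_add]
    calc _ ≤ Real.exp (x * γ) * (1 + (x + x ^ 2 * B) * y) := by gcongr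
      _ = _ := by ring
  calc pathMean G g (l + 1) v (fun y => Real.exp (x * y))
      ≤ backward G (fun w => pathMean G g l w fun y =>
          Real.exp (x * γ) + (Real.exp (x * γ) * (x + x ^ 2 * B)) * y) v :=
        backward_mono (fun w => pathMean_mono hρ (unitIncrement_nonneg ρ u)
          (unitIncrement_le hG hρ u) l w hpt) v
    _ = Real.exp (x * γ) * ((x + x ^ 2 * B) * μ + 1) := by
        simp only [pathMean_affine hG, backward_add, backward_const hG, backward_const_mul, hμ]
        ring
    _ ≤ Real.exp (x * γ) * Real.exp ((x + x ^ 2 * B) * μ) := by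
        gcongr
        exact Real.add_one_le_exp _
    _ ≤ _ := by
        rw [← Real.exp_add, hμ']
        refine Real.exp_le_exp.2 ?_
        have : x ^ 2 * B * μ ≤ x ^ 2 * B * (((l + 1 : ℕ) : ℝ) / (2 * G.degree u)) := by gcongr
        linarith

end Heat

/-! ### The whole algorithm: worst-case time and exact generating function. -/

section Algorithm

variable {V : Type} [Fintype V] [DecidableEq V] {G : SimpleGraph V} [DecidableRel G.Adj]
variable (N : AdjLists G)

theorem Prog.mean_eq_of_holds {α : Type} {p : Prog V α} {M : Mem V} {F : α → Mem V → ℝ} {x : ℝ}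
    (h : p.Holds N M fun a M' _ => F a M' = x) : p.mean N M F = x :=
  (Prog.mean_congr N h).trans (Prog.mean_const N p M x)

theorem Mem.eq_withSource_zero {M : Mem V} {b : Bool} (hr : ∀ i v, M (.res b i v) = 0)
    (he : ∀ v, M (.est b v) = 0) : M = M.withSource b 0 0 := by
  funext a
  cases a <;> simp +contextual [Mem.withSource, hr, he]

/-- The memory holds the residuals `r` and the coarse approximations `q`. -/
structure HasTables (M : Mem V) (r : Bool → ℕ → V → ℝ) (q : Bool → V → ℝ) : Prop where
  res : HasResiduals M r
  est : ∀ b v, M (.est b v) = q b v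

theorem HasTables.set_out {M : Mem V} {r : Bool → ℕ → V → ℝ} {q : Bool → V → ℝ}
    (h : HasTables M r q) (b c : Bool) (x : ℝ) : HasTables (M.set (.out b c) x) r q :=
  ⟨h.res.set_out b c x, fun b' v => by rw [Mem.set_of_ne _ (by simp), h.est]⟩

theorem holds_initEstimate {M : Mem V} {r : Bool → ℕ → V → ℝ} {q : Bool → V → ℝ}
    (h : HasTables M r q) (b c : Bool) (v : V) (Q) :
    (initEstimate b c v).Holds N M Q ↔ Q () (M.set (.out b c) (q b v)) 2 := by
  simp only [initEstimate, Prog.holds_bind, holds_load, holds_store, h.est]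

theorem mean_initEstimate {M : Mem V} {r : Bool → ℕ → V → ℝ} {q : Bool → V → ℝ}
    (h : HasTables M r q) (b c : Bool) (v : V) (F) :
    (initEstimate b c v).mean N M F = F () (M.set (.out b c) (q b v)) := by
  simp only [initEstimate, Prog.mean_bind, mean_load, mean_store, h.est]

/-- The truncation threshold of the residuals. -/
def threshold (d L : ℕ) (ε : ℝ) : ℝ := ε / √(d : ℝ) / (L * L)

/-- The number of rounds of sampling. -/
def walkCount (n d L : ℕ) (ε : ℝ) : ℕ :=
  ⌈4 * ((L : ℝ) * L) / (ε * ε) * (ε / √(d : ℝ)) * d * Real.log n⌉₊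

variable (G) in
/-- The residuals after the deterministic stage. -/
def finalResidual (s t : V) (ρ : ℝ) (L : ℕ) (b : Bool) : ℕ → V → ℝ :=
  residualsAt G ρ (endpoint s t b) (L + 1)

variable (G) in
/-- The coarse approximation computed by the deterministic stage. -/
def coarse (s t : V) (ρ : ℝ) (L : ℕ) (b : Bool) : V → ℝ :=
  ∑ k ∈ Finset.range (L + 1), pushed G ρ (levelMass G ρ (endpoint s t b) k)

variable (G) in
/-- The memory after the deterministic search from `s`. -/
def searchedOnce (s : V) (ρ : ℝ) (L : ℕ) : Mem V :=
  Mem.withSource (fun _ => 0) false (residualsAt G ρ s (L + 1))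
    (∑ k ∈ Finset.range (L + 1), pushed G ρ (levelMass G ρ s k))

theorem holds_cgd_source (hG : ∀ v, 0 < G.degree v) (s : V) (L : ℕ) {rmax : ℝ}
    (hρ : 0 < rmax / (L * L)) :
    (cgd false s L rmax).Holds N (fun _ => 0) fun _ M n =>
      M = searchedOnce G s (rmax / (L * L)) L ∧
      (n : ℝ) ≤ 10 + (L + 1) * (1 + 14 / (rmax / (L * L))) := by
  rw [Mem.eq_withSource_zero (M := fun _ => 0) (b := false) (fun _ _ => rfl) fun _ => rfl]
  exact holds_cgd N hG false s L hρ _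

theorem holds_cgd_target (hG : ∀ v, 0 < G.degree v) (s t : V) (L : ℕ) {rmax : ℝ}
    (hρ : 0 < rmax / (L * L)) :
    (cgd true t L rmax).Holds N (searchedOnce G s (rmax / (L * L)) L) fun _ M n =>
      HasTables M (finalResidual G s t (rmax / (L * L)) L) (coarse G s t (rmax / (L * L)) L) ∧
      (n : ℝ) ≤ 10 + (L + 1) * (1 + 14 / (rmax / (L * L))) := by
  rw [Mem.eq_withSource_zero (M := searchedOnce G s _ L) (b := true) (fun _ _ => rfl)
    fun _ => rfl]
  refine (holds_cgd N hG true t L hρ _).mono N ?_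
  rintro _ M n ⟨rfl, hn⟩
  exact ⟨⟨fun b i v => by cases b <;> rfl, fun b v => by cases b <;> rfl⟩, hn⟩

theorem minDeg_eq (s t : V) :
    (if decide ((G.degree t : ℝ) < G.degree s) = true then G.degree t else G.degree s) =
      minDeg G s t := by
  simp only [decide_eq_true_eq, Nat.cast_lt, minDeg]
  split_ifs with h
  · exact (min_eq_right h.le).symm
  · exact (min_eq_left (not_lt.1 h)).symm

theorem minDeg_pos (hG : ∀ v, 0 < G.degree v) (s t : V) : 0 < minDeg G s t :=
  lt_min (hG s) (hG t)

theorem threshold_pos {d L : ℕ} {ε : ℝ} (hd : 0 < d) (hL : 1 ≤ L) (hε : 0 < ε) :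
    0 < threshold d L ε := by
  unfold threshold
  positivity

theorem holds_bidirectional (hG : ∀ v, 0 < G.degree v) (n : ℕ) (s t : V) {L : ℕ} (hL : 1 ≤ L)
    {ε : ℝ} (hε : 0 < ε) :
    (bidirectional n s t L ε).Holds N (fun _ => 0) fun _ _ k =>
      (k : ℝ) ≤ 48 + 2 * ((L + 1) * (1 + 14 / threshold (minDeg G s t) L ε)) +
        walkCount n (minDeg G s t) L ε * (1 + 2 * ((L + 1) * (6 * L + 23))) := by
  simp only [bidirectional, Prog.holds_bind, holds_degreeQ, holds_less, holds_sqrtOp, holds_div,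
    holds_mul, holds_logOp, holds_ceilOp, holds_load, holds_pure, minDeg_eq]
  have hρ := threshold_pos (minDeg_pos hG s t) hL hε
  refine (holds_cgd_source N hG s L hρ).mono N ?_
  rintro _ M₁ n₁ ⟨rfl, hn₁⟩
  refine (holds_cgd_target N hG s t L hρ).mono N ?_
  rintro _ M₂ n₂ ⟨hM, hn₂⟩
  rw [holds_initEstimate N hM, holds_initEstimate N (hM.set_out _ _ _),
    holds_initEstimate N ((hM.set_out _ _ _).set_out _ _ _),
    holds_initEstimate N (((hM.set_out _ _ _).set_out _ _ _).set_out _ _ _)]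
  refine (holds_sample N s t L _ _ _ _ _
    (((hM.set_out _ _ _).set_out _ _ _).set_out _ _ _ |>.set_out _ _ _).res).mono N ?_
  intro _ M₃ n₃ hn₃
  replace hn₃ : n₃ ≤ walkCount n (minDeg G s t) L ε *
      (1 + 2 * ((L + 1) * (6 * L + 23))) := hn₃
  replace hn₃ := (Nat.cast_le (α := ℝ)).2 hn₃
  push_cast at hn₃
  unfold threshold
  push_cast
  linarith

/-- The first stage is deterministic and leaves known tables, so all randomness comes from the
sampling and `mean_sample` applies with the coarse value as the initial estimate. -/
theorem mean_bidirectional (hG : ∀ v, 0 < G.degree v) (n : ℕ) (s t : V) {L : ℕ} (hL : 1 ≤ L)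
    {ε : ℝ} (hε : 0 < ε) (b c : Bool) (θ : ℝ) :
    (bidirectional n s t L ε).mean N (fun _ => 0) (fun a _ => Real.exp (θ * a b c)) =
      Real.exp (θ * coarse G s t (threshold (minDeg G s t) L ε) L b (endpoint s t c)) *
        (pathMean G (increment G (finalResidual G s t (threshold (minDeg G s t) L ε) L b)
          (G.degree (endpoint s t c) / walkCount n (minDeg G s t) L ε)) L (endpoint s t c)
          fun y => Real.exp (θ * y)) ^ walkCount n (minDeg G s t) L ε := by
  simp only [bidirectional, Prog.mean_bind, mean_degreeQ, mean_less, mean_sqrtOp, mean_div,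
    mean_mul, mean_logOp, mean_ceilOp, mean_load, mean_pure, minDeg_eq]
  have hρ := threshold_pos (minDeg_pos hG s t) hL hε
  refine Prog.mean_eq_of_holds N ((holds_cgd_source N hG s L hρ).mono N ?_)
  rintro _ M₁ n₁ ⟨rfl, -⟩
  refine Prog.mean_eq_of_holds N ((holds_cgd_target N hG s t L hρ).mono N ?_)
  rintro _ M₂ n₂ ⟨hM, -⟩
  rw [mean_initEstimate N hM, mean_initEstimate N (hM.set_out _ _ _),
    mean_initEstimate N ((hM.set_out _ _ _).set_out _ _ _),
    mean_initEstimate N (((hM.set_out _ _ _).set_out _ _ _).set_out _ _ _)]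
  have hsel : ∀ M : Mem V, (if b = true then
      if c = true then M (.out true true) else M (.out true false)
      else if c = true then M (.out false true) else M (.out false false)) = M (.out b c) :=
    fun M => by cases b <;> cases c <;> rfl
  simp only [hsel]
  have := mean_sample N hG b c s t L
    (fun c => (G.degree (endpoint s t c) : ℝ) / walkCount n (minDeg G s t) L ε) _ θ
    (walkCount n (minDeg G s t) L ε) _
    (((hM.set_out false false (coarse G s t (threshold (minDeg G s t) L ε) L false s)).set_out
      false true (coarse G s t (threshold (minDeg G s t) L ε) L false t)).set_out
      true false (coarse G s t (threshold (minDeg G s t) L ε) L true s) |>.set_out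
      true true (coarse G s t (threshold (minDeg G s t) L ε) L true t)).res
  refine this.trans ?_
  congr 3
  cases b <;> cases c <;> simp [Mem.set_self, Mem.set_of_ne, endpoint]

end Algorithm

/-! ### The error bound and the running time for arbitrary graphs. -/

section General

variable {V : Type} [Fintype V] [DecidableEq V] {G : SimpleGraph V} [DecidableRel G.Adj]

theorem degree_pos_of_connected (hG : G.Connected) (hV : 2 ≤ Fintype.card V) (v : V) :
    0 < G.degree v := by
  have : Nontrivial V := Fintype.one_lt_card_iff_nontrivial.1 hV
  exact hG.preconnected.degree_pos_of_nontrivial v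

theorem walkCount_ge {n d L : ℕ} {ε : ℝ} (hd : 0 < d) (hε : 0 < ε) :
    4 * (L : ℝ) ^ 2 * √(d : ℝ) * Real.log n / ε ≤ walkCount n d L ε := by
  refine le_trans (le_of_eq ?_) (Nat.le_ceil _)
  have h : √(d : ℝ) ≠ 0 := by positivity
  have h2 : (d : ℝ) = √(d : ℝ) * √(d : ℝ) := (Real.mul_self_sqrt (Nat.cast_nonneg d)).symm
  generalize √(d : ℝ) = z at *
  rw [h2]
  field_simp

theorem walkCount_le {n d L : ℕ} {ε : ℝ} (hd : 0 < d) (hε : 0 < ε) :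
    (walkCount n d L ε : ℝ) ≤ 4 * (L : ℝ) ^ 2 * √(d : ℝ) * Real.log n / ε + 1 := by
  have h : √(d : ℝ) ≠ 0 := by positivity
  have h2 : (d : ℝ) = √(d : ℝ) * √(d : ℝ) := (Real.mul_self_sqrt (Nat.cast_nonneg d)).symm
  have h3 : 4 * ((L : ℝ) * L) / (ε * ε) * (ε / √(d : ℝ)) * d * Real.log n =
      4 * (L : ℝ) ^ 2 * √(d : ℝ) * Real.log n / ε := by
    generalize √(d : ℝ) = z at *
    rw [h2]
    field_simp
  refine (Nat.ceil_lt_add_one ?_).le.trans_eq (by rw [h3])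
  have := Real.log_natCast_nonneg n
  positivity

variable (N : AdjLists G)

/-- A walk of length `L` reads only levels up to `L`. All of these have been processed, so the
tables hold the leftovers there. -/
theorem increment_finalResidual (s t : V) (ρ scale : ℝ) (L : ℕ) (b : Bool) {k : ℕ}
    (hk : k ≤ L) : increment G (finalResidual G s t ρ L b) scale k =
      fun w => scale * unitIncrement G ρ (endpoint s t b) k w := by
  funext w
  simp only [increment, unitIncrement, one_mul]
  congr 2
  refine Finset.sum_congr rfl fun i hi => ?_
  rw [finalResidual, residualsAt, if_pos (by have := Finset.mem_range.1 hi; omega)]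

/-- A one-sided tail bound for one of the four estimates. -/
theorem tail_bound (hG : ∀ v, 0 < G.degree v) {n : ℕ} (hn : 2 ≤ n) (s t : V) {L : ℕ}
    (hL : 1 ≤ L) {ε : ℝ} (hε : 0 < ε) (hε1 : ε < 1) (b c : Bool) {σ : ℝ} (hσ : σ ^ 2 = 1) :
    ((bidirectional n s t L ε).run N fun _ => 0).toOuterMeasure
      {x | ε / minDeg G s t < σ * ((x.result b c - pL G L (endpoint s t b) (endpoint s t c)) /
        G.degree (endpoint s t c))} ≤ ENNReal.ofReal (1 / n) := by
  set d := minDeg G s t with hd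
  set u := endpoint s t b
  set v := endpoint s t c
  set nr := walkCount n d L ε with hnr
  set ρ := threshold d L ε with hρ
  set p := pL G L u v
  have hd0 : 0 < d := minDeg_pos hG s t
  have hdR : (0 : ℝ) < d := by exact_mod_cast hd0
  have hLR : (1 : ℝ) ≤ L := by exact_mod_cast hL
  have hdv : (0 : ℝ) < G.degree v := by exact_mod_cast hG v
  have hdu : (d : ℝ) ≤ G.degree u := by
    have : d ≤ G.degree u := by
      cases b
      · exact min_le_left _ _
      · exact min_le_right _ _
    exact_mod_cast this
  have hn0 : (0 : ℝ) < n := by positivity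
  have hlog : 0 < Real.log n := Real.log_pos (by exact_mod_cast hn)
  have hnr1 := walkCount_ge (n := n) (L := L) hd0 hε
  have hnr0 : (0 : ℝ) < nr := lt_of_lt_of_le (by positivity) hnr1
  have hρ0 : 0 < ρ := threshold_pos hd0 hL hε
  set z : ℝ := √(d : ℝ) with hz
  have hz0 : 0 < z := by positivity
  have hzz : z * z = d := Real.mul_self_sqrt hdR.le
  have hz1 : 1 ≤ z := by
    rw [hz]; exact Real.one_le_sqrt.2 (by exact_mod_cast hd0)
  have hρL : (L : ℝ) ^ 2 * ρ = ε / z := by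
    rw [hρ, threshold, ← hz]; field_simp
  -- The value `√d / L` maximizes `lam ε / d - lam² (ε / √d) L / (2 d)`, the exponent gained per
  -- round; the maximum is `ε / (2 L √d)`.
  set lam : ℝ := z / L with hlam
  have hlam0 : 0 < lam := by positivity
  set θ : ℝ := lam * nr * σ / G.degree v with hθ
  have hσ1 : |σ| = 1 := by
    have : |σ| ^ 2 = 1 := by rw [sq_abs, hσ]
    have h0 := abs_nonneg σ
    nlinarith
  -- Exponential Markov inequality. The factor `nr / d_v` in `θ` cancels the scale of an update, so
  -- each walk is tested at `lam * σ`.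
  refine (Prog.toOuterMeasure_run_le N (bidirectional n s t L ε) (fun _ => 0)
    (fun a _ => ε / d < σ * ((a b c - p) / G.degree v))
    (fun a _ => Real.exp (θ * a b c) * Real.exp (-(θ * p) - lam * nr * (ε / d)))
    (fun a _ => by positivity) fun a _ ha => ?_).trans ?_
  · rw [← Real.exp_add, Real.one_le_exp_iff]
    have : θ * a b c + (-(θ * p) - lam * nr * (ε / d)) =
        lam * nr * (σ * ((a b c - p) / G.degree v) - ε / d) := by
      rw [hθ]; ring
    rw [this]
    have : 0 < σ * ((a b c - p) / G.degree v) - ε / d := sub_pos.2 ha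
    positivity
  · refine ENNReal.ofReal_le_ofReal ?_
    rw [Prog.mean_mul_const, mean_bidirectional N hG n s t hL hε b c θ]
    simp only [← hd, ← hnr, ← hρ]
    rw [pathMean_congr L (fun k hk => increment_finalResidual s t ρ _ L b hk)]
    have hθs : ∀ y : ℝ, θ * ((G.degree v : ℝ) / nr * y) = lam * σ * y := fun y => by
      rw [hθ]; field_simp
    rw [pathMean_smul, show (fun y : ℝ =>
      Real.exp (θ * ((G.degree (endpoint s t c) : ℝ) / nr * y))) = fun y =>
        Real.exp (lam * σ * y) from funext fun y => congrArg Real.exp (hθs y)]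
    change Real.exp (θ * coarse G s t ρ L b v) *
      (pathMean G (unitIncrement G ρ u) L v fun y => Real.exp (lam * σ * y)) ^ nr *
      Real.exp (-(θ * p) - lam * nr * (ε / d)) ≤ _
    have hμ := pL_div_sub hG ρ L u v
    have hexp := pathMean_exp_le hG hρ0.le u v hL (lam * σ) (by
      rw [hρL, abs_mul, hσ1, abs_of_pos hlam0, hlam, mul_one]
      have : z / L * (ε / z) = ε / L := by field_simp
      rw [this, div_le_one (by positivity)]
      linarith)
    rw [← hμ, hρL, mul_pow, hσ, mul_one] at hexp
    have hA0 : 0 ≤ pathMean G (unitIncrement G ρ u) L v fun y => Real.exp (lam * σ * y) := by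
      have h := pathMean_mono (G := G) hρ0.le (unitIncrement_nonneg ρ u)
        (unitIncrement_le hG hρ0.le u) L v (Φ := fun _ => 0) (Ψ := fun y => Real.exp (lam * σ * y)) fun y _ _ => by positivity
      have h' := pathMean_affine hG (unitIncrement G ρ u) 0 0 L v
      simp only [zero_mul, add_zero] at h'
      rwa [h'] at h
    have hq : coarse G s t ρ L b v =
        (∑ k ∈ Finset.range (L + 1), pushed G ρ (levelMass G ρ u k)) v := rfl
    rw [← hq] at hexp
    set q := coarse G s t ρ L b v
    have hvar : lam ^ 2 * (ε / z) * (L / (2 * G.degree u)) ≤ ε / (2 * L * z) := by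
      calc lam ^ 2 * (ε / z) * (L / (2 * G.degree u))
          ≤ lam ^ 2 * (ε / z) * (L / (2 * d)) := by gcongr
        _ = ε / (2 * L * z) := by
          rw [hlam, ← hzz]; field_simp
    calc _ ≤ Real.exp (θ * q) * Real.exp (lam * σ * (p / G.degree v - q / G.degree v) +
            ε / (2 * L * z)) ^ nr * Real.exp (-(θ * p) - lam * nr * (ε / d)) := by
          gcongr
          refine hexp.trans (Real.exp_le_exp.2 ?_)
          linarith
      _ = Real.exp (-(nr * (ε / (2 * L * z)))) := by
          rw [← Real.exp_nat_mul, ← Real.exp_add, ← Real.exp_add]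
          congr 1
          rw [hθ, hlam, ← hzz]
          field_simp
          ring
      _ ≤ Real.exp (-Real.log n) := by
          refine Real.exp_le_exp.2 (neg_le_neg ?_)
          -- At least `4 L² √d log n / ε` rounds, each gaining `ε / (2 L √d)`, give an exponent of
          -- at least `2 L log n`.
          calc Real.log n ≤ 2 * L * Real.log n := by nlinarith
            _ = 4 * (L : ℝ) ^ 2 * z * Real.log n / ε * (ε / (2 * L * z)) := by
              field_simp; ring
            _ ≤ _ := by gcongr
      _ = 1 / n := by rw [Real.exp_neg, Real.exp_log hn0, one_div]

theorem accurateWithProb (hG : ∀ v, 0 < G.degree v) (hV : 2 ≤ Fintype.card V) (s t : V) {L : ℕ}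
    (hL : 1 ≤ L) {ε : ℝ} (hε : 0 < ε) (hε1 : ε < 1) {C : ℝ} (hC : 8 ≤ C) :
    AccurateWithProb N s t L ε (C / Fintype.card V) := by
  set n := Fintype.card V with hn
  have hn0 : (0 : ℝ) < n := by positivity
  unfold AccurateWithProb
  set μ := (algorithmLaw N s t L ε).toOuterMeasure with hμ
  set S := {x : Outcome V (Bool → Bool → ℝ) | ∀ b c : Bool,
      |pL G L (endpoint s t b) (endpoint s t c) - x.result b c| / G.degree (endpoint s t c)
        ≤ ε / minDeg G s t} with hS
  set B : Bool × Bool × Bool → Set (Outcome V (Bool → Bool → ℝ)) := fun i =>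
    {x | ε / minDeg G s t < (if i.2.2 then 1 else -1) *
      ((x.result i.1 i.2.1 - pL G L (endpoint s t i.1) (endpoint s t i.2.1)) /
        G.degree (endpoint s t i.2.1))} with hB
  -- A failure is a deviation of one of the four estimates in one of two directions: eight events.
  have hcover : Set.univ ⊆ S ∪ ⋃ i, B i := by
    intro x _
    by_contra hx
    simp only [Set.mem_union, Set.mem_iUnion, not_or, not_exists] at hx
    refine hx.1 fun b c => ?_
    have h1 := hx.2 (b, c, true)
    have h2 := hx.2 (b, c, false)
    simp only [hB, Set.mem_ofPred_eq, if_true, Bool.false_eq_true, if_false, one_mul, not_lt]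
      at h1 h2
    have hd : (0 : ℝ) < G.degree (endpoint s t c) := by exact_mod_cast hG _
    rw [abs_sub_comm, ← abs_of_pos hd, ← abs_div]
    exact abs_le.2 ⟨by linarith, h1⟩
  have hone : μ Set.univ = 1 := by
    rw [hμ, PMF.toOuterMeasure_apply_eq_one_iff]
    exact Set.subset_univ _
  have hbad : μ (⋃ i, B i) ≤ ENNReal.ofReal (8 / n) := by
    refine (MeasureTheory.measure_iUnion_fintype_le μ B).trans ?_
    calc ∑ i, μ (B i) ≤ ∑ _i : Bool × Bool × Bool, ENNReal.ofReal (1 / n) :=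
          Finset.sum_le_sum fun i _ => tail_bound N hG hV s t hL hε hε1 i.1 i.2.1
            (by split_ifs <;> norm_num)
      _ = ENNReal.ofReal (8 / n) := by
          rw [Finset.sum_const, nsmul_eq_mul, ← ENNReal.ofReal_natCast,
            ← ENNReal.ofReal_mul (by positivity)]
          congr 1
          simp
          ring
  -- Subadditivity of the outer measure suffices, so no measurability of `S` is needed.
  have h1 : 1 ≤ μ S + ENNReal.ofReal (8 / n) :=
    hone.ge.trans ((MeasureTheory.measure_mono hcover).trans
      ((MeasureTheory.measure_union_le _ _).trans (by gcongr)))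
  calc ENNReal.ofReal (1 - C / n) ≤ ENNReal.ofReal (1 - 8 / n) := by gcongr
    _ = 1 - ENNReal.ofReal (8 / n) := by
      rw [ENNReal.ofReal_sub _ (by positivity), ENNReal.ofReal_one]
    _ ≤ μ S := tsub_le_iff_right.2 h1

theorem runsWithin (hG : ∀ v, 0 < G.degree v) (hV : 2 ≤ Fintype.card V) (s t : V) {L : ℕ}
    (hL : 1 ≤ L) {ε : ℝ} (hε : 0 < ε) (hε1 : ε < 1) :
    RunsWithin N s t L ε (1000 * (L : ℝ) ^ 4 * Real.log (Fintype.card V) *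
      (√(minDeg G s t : ℝ) / ε)) := by
  intro x hx
  refine ((holds_bidirectional N hG _ s t hL hε).of_mem_support N x hx).trans ?_
  set d := minDeg G s t
  set n := Fintype.card V
  have hd0 : 0 < d := minDeg_pos hG s t
  have hdR : (0 : ℝ) < d := by exact_mod_cast hd0
  have hl : (1 : ℝ) ≤ L := by exact_mod_cast hL
  have hz1 : 1 ≤ √(d : ℝ) := Real.one_le_sqrt.2 (by exact_mod_cast hd0)
  set z : ℝ := √(d : ℝ) / ε with hz
  have hz1 : 1 ≤ z := by
    rw [hz, le_div_iff₀ hε]; linarith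
  have hlog : 1 / 2 ≤ Real.log n := by
    have h2 : (2 : ℝ) ≤ n := by exact_mod_cast hV
    have := Real.log_le_log two_pos h2
    have := Real.log_two_gt_d9
    linarith
  have hnr := walkCount_le (n := n) (L := L) hd0 hε
  have hthr : 14 / threshold d L ε = 14 * ((L : ℝ) ^ 2 * z) := by
    have : √(d : ℝ) ≠ 0 := by positivity
    rw [threshold, hz]; field_simp
  rw [hthr]
  have hnr' : (walkCount n d L ε : ℝ) ≤ 4 * ((L : ℝ) ^ 2 * z) * Real.log n + 1 :=
    hnr.trans_eq (by rw [hz]; ring)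
  set l : ℝ := (L : ℝ)
  set g := Real.log n
  have hl2 : 1 ≤ l ^ 2 := one_le_pow₀ hl
  have hP : 1 ≤ l ^ 2 * z := one_le_mul_of_one_le_of_one_le hl2 hz1
  have hQ : l ^ 2 * z ≤ l ^ 4 * z := by
    have : l ^ 2 ≤ l ^ 4 := pow_le_pow_right₀ hl (by norm_num)
    gcongr
  have hlP : (l + 1) * (1 + 14 * (l ^ 2 * z)) ≤ 30 * (l ^ 4 * z) := by
    have h1 : l + 1 ≤ 2 * l ^ 2 := by nlinarith
    calc (l + 1) * (1 + 14 * (l ^ 2 * z)) ≤ (2 * l ^ 2) * (15 * (l ^ 2 * z)) := by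
          gcongr; linarith
      _ = _ := by ring
  have hwalk : 1 + 2 * ((l + 1) * (6 * l + 23)) ≤ 117 * l ^ 2 := by nlinarith
  have hsample : (walkCount n d L ε : ℝ) * (1 + 2 * ((l + 1) * (6 * l + 23))) ≤
      468 * (l ^ 4 * z) * g + 117 * (l ^ 4 * z) := by
    calc (walkCount n d L ε : ℝ) * (1 + 2 * ((l + 1) * (6 * l + 23)))
        ≤ (4 * (l ^ 2 * z) * g + 1) * (117 * l ^ 2) := by gcongr
      _ = 468 * (l ^ 4 * z) * g + 117 * l ^ 2 := by ring
      _ ≤ _ := by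
        have : l ^ 2 ≤ l ^ 4 * z := by nlinarith
        linarith
  -- Since `log n ≥ 1/2`, the terms without a logarithm are absorbed: `2 (48 + 60 + 117) + 468 ≤
  -- 1000`.
  have hfin : l ^ 4 * z ≤ 2 * ((l ^ 4 * z) * g) := by
    have : 0 ≤ l ^ 4 * z := by positivity
    nlinarith
  have : 0 ≤ l ^ 4 * z * g := by positivity
  calc _ ≤ 48 * (l ^ 4 * z) + 2 * (30 * (l ^ 4 * z)) +
        (468 * (l ^ 4 * z) * g + 117 * (l ^ 4 * z)) := by linarith
    _ ≤ 1000 * (l ^ 4 * z * g) := by linarith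
    _ = _ := by ring

end General

/-! ### Cheeger's inequality and the condition number. -/

section Cheeger

variable {V : Type} [Fintype V] [DecidableEq V] (G : SimpleGraph V) [DecidableRel G.Adj]

/-- The ordered pairs of adjacent vertices. -/
def adjPairs : Finset (V × V) := {e | G.Adj e.1 e.2}

/-- The sum of the degrees of the vertices in `S`. -/
def vol (S : Finset V) : ℝ := ∑ u ∈ S, (G.degree u : ℝ)

variable {G}

theorem sum_adjPairs (F : V → V → ℝ) :
    ∑ e ∈ adjPairs G, F e.1 e.2 = ∑ u, ∑ v ∈ G.neighborFinset u, F u v := by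
  simp only [adjPairs, SimpleGraph.neighborFinset_eq_filter, Finset.sum_filter]
  exact Fintype.sum_prod_type _

theorem sum_adjPairs_swap (F : V → V → ℝ) :
    ∑ e ∈ adjPairs G, F e.1 e.2 = ∑ e ∈ adjPairs G, F e.2 e.1 :=
  Finset.sum_nbij' Prod.swap Prod.swap (by simp [adjPairs, SimpleGraph.adj_comm])
    (by simp [adjPairs, SimpleGraph.adj_comm]) (by simp) (by simp) (by simp)

theorem sum_adjPairs_fst (F : V → ℝ) :
    ∑ e ∈ adjPairs G, F e.1 = ∑ u, (G.degree u : ℝ) * F u := by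
  rw [sum_adjPairs fun u _ => F u]
  simp

theorem sum_adjPairs_snd (F : V → ℝ) :
    ∑ e ∈ adjPairs G, F e.2 = ∑ u, (G.degree u : ℝ) * F u := by
  rw [← sum_adjPairs_fst]
  exact sum_adjPairs_swap fun _ v => F v

theorem card_interedges_compl (S : Finset V) :
    ((G.interedges S Sᶜ).card : ℝ) =
      ∑ e ∈ adjPairs G, if e.1 ∈ S ∧ e.2 ∉ S then (1 : ℝ) else 0 := by
  rw [Finset.sum_boole]
  congr 2
  ext e
  simp [SimpleGraph.interedges_def, adjPairs]
  tauto

theorem vol_mono {S T : Finset V} (h : S ⊆ T) : vol G S ≤ vol G T :=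
  Finset.sum_le_sum_of_subset_of_nonneg h fun _ _ _ => Nat.cast_nonneg _

/-- The discrete coarea inequality. -/
theorem mul_sum_le_sum_abs_sub {φ : ℝ}
    (hφ : ∀ S : Finset V, S.Nonempty → vol G S ≤ vol G Sᶜ →
      φ * vol G S ≤ (G.interedges S Sᶜ).card) (h : V → ℝ) (h0 : ∀ v, 0 ≤ h v)
    (hvol : vol G {v | 0 < h v} ≤ vol G ({v | 0 < h v} : Finset V)ᶜ) :
    2 * φ * ∑ v, (G.degree v : ℝ) * h v ≤ ∑ e ∈ adjPairs G, |h e.1 - h e.2| := by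
  induction hk : ({v | 0 < h v} : Finset V).card using Nat.strong_induction_on generalizing h with
  | _ k ih =>
    set S : Finset V := {v | 0 < h v} with hS
    have hmem : ∀ v, v ∈ S ↔ 0 < h v := fun v => by simp [hS]
    rcases S.eq_empty_or_nonempty with hE | hne
    · have hz : ∀ v, h v = 0 := fun v => by
        have : v ∉ S := by simp [hE]
        exact le_antisymm (not_lt.1 ((hmem v).not.1 this)) (h0 v)
      simp [hz]
    obtain ⟨w, hwS, hw⟩ := S.exists_min_image h hne
    set m := h w with hm
    have hm0 : 0 < m := (hmem w).1 hwS
    -- Peel off the bottom layer: lowering `h` by its least positive value keeps it nonnegative and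
    -- shrinks the support, since the minimizer `w` drops out.
    set h' : V → ℝ := fun v => if v ∈ S then h v - m else 0 with hh'
    have h'0 : ∀ v, 0 ≤ h' v := fun v => by
      simp only [hh']
      split_ifs with hv
      · linarith [hw v hv]
      · exact le_rfl
    have hsub : ({v | 0 < h' v} : Finset V) ⊆ S := fun v hv => by
      by_contra hvS
      simp [hh', hvS] at hv
    have hlt : ({v | 0 < h' v} : Finset V).card < k := by
      rw [← hk]
      refine Finset.card_lt_card ⟨hsub, fun hle => ?_⟩
      have := hle hwS
      simp [hh', hwS, ← hm] at this
    have hrec := ih _ hlt h' h'0 ((vol_mono hsub).trans (hvol.trans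
      (vol_mono (Finset.compl_subset_compl.2 hsub)))) rfl
    have hcut := hφ S hne hvol
    -- The layer accounts for exactly `m` on each pair separated by `S` and for nothing elsewhere;
    -- ordered pairs count every cut edge twice.
    have hdec : ∀ u v, |h u - h v| = |h' u - h' v| +
        m * ((if u ∈ S ∧ v ∉ S then (1 : ℝ) else 0) + if v ∈ S ∧ u ∉ S then (1 : ℝ) else 0) := by
      intro u v
      have hz : ∀ v, v ∉ S → h v = 0 := fun v hv =>
        le_antisymm (not_lt.1 ((hmem v).not.1 hv)) (h0 v)
      by_cases hu : u ∈ S <;> by_cases hv : v ∈ S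
      · simp [hh', hu, hv]
      · have := h'0 u
        have h1 : h' u = h u - m := by simp [hh', hu]
        have h2 : h' v = 0 := by simp [hh', hv]
        rw [hz v hv, h2, sub_zero, sub_zero, abs_of_nonneg (h0 u), abs_of_nonneg this, h1]
        simp [hu, hv]
      · have := h'0 v
        have h1 : h' v = h v - m := by simp [hh', hv]
        have h2 : h' u = 0 := by simp [hh', hu]
        rw [hz u hu, h2, zero_sub, zero_sub, abs_neg, abs_neg, abs_of_nonneg (h0 v),
          abs_of_nonneg this, h1]
        simp [hu, hv]
      · simp [hh', hu, hv, hz u hu, hz v hv]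
    have hsum : ∑ e ∈ adjPairs G, |h e.1 - h e.2| = ∑ e ∈ adjPairs G, |h' e.1 - h' e.2| +
        m * (2 * (G.interedges S Sᶜ).card) := by
      simp only [hdec, Finset.sum_add_distrib, ← Finset.mul_sum]
      rw [← card_interedges_compl,
        sum_adjPairs_swap fun u v => if v ∈ S ∧ u ∉ S then (1 : ℝ) else 0,
        ← card_interedges_compl]
      ring
    have hdeg : ∑ v, (G.degree v : ℝ) * h v =
        ∑ v, (G.degree v : ℝ) * h' v + m * vol G S := by
      rw [vol, Finset.mul_sum, ← Finset.sum_filter_add_sum_filter_not Finset.univ (· ∈ S),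
        ← Finset.sum_filter_add_sum_filter_not Finset.univ (· ∈ S)
          (fun v => (G.degree v : ℝ) * h' v)]
      have e1 : ∀ F : V → ℝ, ∑ v with v ∈ S, F v = ∑ v ∈ S, F v := fun F => by
        simp
      have e2 : ∑ v with v ∉ S, (G.degree v : ℝ) * h v = 0 :=
        Finset.sum_eq_zero fun v hv => by
          have hv : v ∉ S := by simpa using hv
          rw [le_antisymm (not_lt.1 ((hmem v).not.1 hv)) (h0 v), mul_zero]
      have e3 : ∑ v with v ∉ S, (G.degree v : ℝ) * h' v = 0 :=
        Finset.sum_eq_zero fun v hv => by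
          have hv : v ∉ S := by simpa using hv
          simp [hh', hv]
      rw [e1, e1, e2, e3, add_zero, add_zero, ← Finset.sum_add_distrib]
      refine Finset.sum_congr rfl fun v hv => ?_
      simp only [hh', hv, if_true]
      ring
    rw [hsum, hdeg]
    have := mul_le_mul_of_nonneg_left hcut (by positivity : (0 : ℝ) ≤ 2 * m)
    linarith

theorem sq_le_of_eigenfunction_of_vol_le {φ : ℝ} (hφ0 : 0 ≤ φ)
    (hφ : ∀ S : Finset V, S.Nonempty → vol G S ≤ vol G Sᶜ →
      φ * vol G S ≤ (G.interedges S Sᶜ).card) (hG : ∀ v, 0 < G.degree v) {f : V → ℝ} {μ : ℝ}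
    (hf : ∀ v, G.degree v * f v - ∑ u ∈ G.neighborFinset v, f u = μ * (G.degree v * f v))
    (hpos : ∃ v, 0 < f v) (hvol : vol G {v | 0 < f v} ≤ vol G ({v | 0 < f v} : Finset V)ᶜ) :
    φ ^ 2 / 2 ≤ μ := by
  set g : V → ℝ := fun v => max (f v) 0 with hg
  have hg0 : ∀ v, 0 ≤ g v := fun v => le_max_right _ _
  set A : ℝ := ∑ v, (G.degree v : ℝ) * g v ^ 2 with hA
  have hA0 : 0 < A := by
    obtain ⟨v, hv⟩ := hpos
    refine Finset.sum_pos' (fun v _ => by positivity) ⟨v, Finset.mem_univ v, ?_⟩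
    have h1 : (0 : ℝ) < G.degree v := by exact_mod_cast hG v
    have h2 : 0 < g v := lt_max_of_lt_left hv
    positivity
  have henergy : ∑ e ∈ adjPairs G, (g e.1 - g e.2) ^ 2 ≤ 2 * μ * A := by
    have h1 : ∑ e ∈ adjPairs G, (g e.1 - g e.2) ^ 2 =
        2 * ∑ v, g v * (G.degree v * g v - ∑ u ∈ G.neighborFinset v, g u) := by
      have : ∀ e : V × V, (g e.1 - g e.2) ^ 2 = g e.1 ^ 2 + g e.2 ^ 2 - 2 * (g e.1 * g e.2) :=
        fun e => by ring
      simp only [this, Finset.sum_sub_distrib, Finset.sum_add_distrib, ← Finset.mul_sum, mul_sub]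
      rw [sum_adjPairs_fst fun v => g v ^ 2, sum_adjPairs_snd fun v => g v ^ 2,
        sum_adjPairs fun u v => g u * g v]
      simp only [← Finset.mul_sum]
      have : ∑ v, (G.degree v : ℝ) * g v ^ 2 = ∑ v, g v * (G.degree v * g v) :=
        Finset.sum_congr rfl fun v _ => by ring
      rw [this]
      ring
    -- Truncating at `0` does not raise the Rayleigh quotient: where `f > 0`, replacing neighbors by
    -- larger values lowers the Laplacian, and elsewhere `g` vanishes.
    have h2 : ∀ v, g v * (G.degree v * g v - ∑ u ∈ G.neighborFinset v, g u) ≤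
        μ * (G.degree v * g v ^ 2) := by
      intro v
      rcases le_or_gt (f v) 0 with hv | hv
      · have : g v = 0 := max_eq_right hv
        simp [this]
      · have hgv : g v = f v := max_eq_left hv.le
        have : ∑ u ∈ G.neighborFinset v, f u ≤ ∑ u ∈ G.neighborFinset v, g u :=
          Finset.sum_le_sum fun u _ => le_max_left _ _
        calc _ ≤ g v * (G.degree v * f v - ∑ u ∈ G.neighborFinset v, f u) := by
              rw [hgv]; gcongr
          _ = _ := by rw [hf, hgv]; ring
    rw [h1, hA]
    have := Finset.sum_le_sum fun v (_ : v ∈ Finset.univ) => h2 v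
    rw [← Finset.mul_sum] at this
    linarith
  have hcoarea : 2 * φ * A ≤ ∑ e ∈ adjPairs G, |g e.1 ^ 2 - g e.2 ^ 2| := by
    have hsupp : Finset.univ.filter (fun v => 0 < g v ^ 2) =
        Finset.univ.filter fun v => 0 < f v := by
      refine Finset.filter_congr fun v _ => ?_
      simp only [hg]
      refine ⟨fun h => ?_, fun h => ?_⟩
      · by_contra hv
        rw [max_eq_right (not_lt.1 hv)] at h
        simp at h
      · rw [max_eq_left h.le]
        positivity
    exact mul_sum_le_sum_abs_sub hφ (fun v => g v ^ 2) (fun v => by positivity)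
      (by rw [hsupp]; exact hvol)
  have hsum : ∑ e ∈ adjPairs G, (g e.1 + g e.2) ^ 2 ≤ 4 * A := by
    calc ∑ e ∈ adjPairs G, (g e.1 + g e.2) ^ 2
        ≤ ∑ e ∈ adjPairs G, (2 * g e.1 ^ 2 + 2 * g e.2 ^ 2) :=
          Finset.sum_le_sum fun e _ => by nlinarith [sq_nonneg (g e.1 - g e.2)]
      _ = 4 * A := by
          rw [Finset.sum_add_distrib, ← Finset.mul_sum, ← Finset.mul_sum,
            sum_adjPairs_fst fun v => g v ^ 2, sum_adjPairs_snd fun v => g v ^ 2]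
          ring
  -- Cauchy–Schwarz on `|g(u)² - g(v)²| = |g(u) - g(v)| (g(u) + g(v))` joins the coarea bound to the
  -- energy.
  have hcs := Finset.sum_mul_sq_le_sq_mul_sq (adjPairs G) (fun e => |g e.1 - g e.2|)
    fun e => g e.1 + g e.2
  have habs : ∀ e : V × V, |g e.1 ^ 2 - g e.2 ^ 2| = |g e.1 - g e.2| * (g e.1 + g e.2) := by
    intro e
    rw [sq_sub_sq, abs_mul, abs_of_nonneg (add_nonneg (hg0 e.1) (hg0 e.2)), mul_comm]
  simp only [← habs, sq_abs] at hcs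
  have hE0 : 0 ≤ ∑ e ∈ adjPairs G, (g e.1 - g e.2) ^ 2 :=
    Finset.sum_nonneg fun e _ => sq_nonneg _
  have h1 : (2 * φ * A) ^ 2 ≤ (2 * μ * A) * (4 * A) := by
    calc (2 * φ * A) ^ 2 ≤ (∑ e ∈ adjPairs G, |g e.1 ^ 2 - g e.2 ^ 2|) ^ 2 := by gcongr
      _ ≤ _ := hcs
      _ ≤ _ := mul_le_mul henergy hsum (Finset.sum_nonneg fun e _ => sq_nonneg _)
          (hE0.trans henergy)
  have h2 : A ^ 2 * (4 * φ ^ 2) ≤ A ^ 2 * (8 * μ) := by linarith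
  have := le_of_mul_le_mul_left h2 (by positivity)
  linarith

/-- Cheeger's inequality for the eigenvalues of the normalized Laplacian. -/
theorem sq_le_of_eigenfunction {φ : ℝ} (hφ0 : 0 ≤ φ)
    (hφ : ∀ S : Finset V, S.Nonempty → vol G S ≤ vol G Sᶜ →
      φ * vol G S ≤ (G.interedges S Sᶜ).card) (hG : ∀ v, 0 < G.degree v) {f : V → ℝ} {μ : ℝ}
    (hf : ∀ v, G.degree v * f v - ∑ u ∈ G.neighborFinset v, f u = μ * (G.degree v * f v))
    (hf0 : f ≠ 0) (hμ : μ ≠ 0) : φ ^ 2 / 2 ≤ μ := by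
  -- Summing the eigenvalue equation over all vertices kills the left side, so `μ ≠ 0` forces
  -- weighted mean zero; hence both `f` and `-f` are positive somewhere.
  have hmean : ∑ v, (G.degree v : ℝ) * f v = 0 := by
    have := Finset.sum_congr rfl fun v (_ : v ∈ Finset.univ) => hf v
    rw [Finset.sum_sub_distrib, ← Finset.mul_sum, ← sum_adjPairs fun _ v => f v,
      sum_adjPairs_snd, sub_self] at this
    exact (mul_eq_zero.1 this.symm).resolve_left hμ
  have hex : ∀ h : V → ℝ, h ≠ 0 → ∑ v, (G.degree v : ℝ) * h v = 0 → ∃ v, 0 < h v := by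
    intro h h0 hs
    by_contra! hle
    refine h0 (funext fun v => ?_)
    have := (Finset.sum_eq_zero_iff_of_nonpos fun v _ =>
      mul_nonpos_of_nonneg_of_nonpos (Nat.cast_nonneg (G.degree v)) (hle v)).1 hs v
      (Finset.mem_univ v)
    have hd : (G.degree v : ℝ) ≠ 0 := by exact_mod_cast (hG v).ne'
    exact (mul_eq_zero.1 this).resolve_left hd
  -- The sets where `f` and `-f` are positive are disjoint, so one of them has at most half the
  -- volume.
  by_cases hvol : vol G {v | 0 < f v} ≤ vol G ({v | 0 < f v} : Finset V)ᶜ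
  · exact sq_le_of_eigenfunction_of_vol_le hφ0 hφ hG hf (hex f hf0 hmean) hvol
  · refine sq_le_of_eigenfunction_of_vol_le hφ0 hφ hG (f := -f) (fun v => ?_)
      (hex (-f) (neg_ne_zero.2 hf0) (by simp [hmean])) ?_
    · have := hf v
      simp only [Pi.neg_apply, Finset.sum_neg_distrib]
      linarith
    · have h1 : ({v | 0 < (-f) v} : Finset V) ⊆ ({v | 0 < f v} : Finset V)ᶜ := fun v hv => by
        simp at hv ⊢
        exact hv.le
      have h2 := vol_mono (G := G) h1
      have h3 := vol_mono (G := G) (Finset.compl_subset_compl.2 h1)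
      rw [compl_compl] at h3
      linarith

/-- At a vertex where `|f|` is largest, the sum over the neighbors is at most `d_v |f v|` in
absolute value, which forces `|1 - μ| ≤ 1`. -/
theorem abs_one_sub_le_of_eigenfunction (hG : ∀ v, 0 < G.degree v) {f : V → ℝ} {μ : ℝ}
    (hf : ∀ v, G.degree v * f v - ∑ u ∈ G.neighborFinset v, f u = μ * (G.degree v * f v))
    (hf0 : f ≠ 0) : μ ≤ 2 := by
  obtain ⟨w, hw⟩ := Function.ne_iff.1 hf0
  have : Nonempty V := ⟨w⟩
  obtain ⟨v, hv⟩ := Finite.exists_max fun v => |f v|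
  have hfv : 0 < |f v| := (abs_pos.2 hw).trans_le (hv w)
  have hd : (0 : ℝ) < G.degree v := by exact_mod_cast hG v
  have h1 : |∑ u ∈ G.neighborFinset v, f u| ≤ G.degree v * |f v| := by
    refine (Finset.abs_sum_le_sum_abs _ _).trans ((Finset.sum_le_sum fun u _ => hv u).trans_eq ?_)
    simp
  have h2 : ∑ u ∈ G.neighborFinset v, f u = (1 - μ) * (G.degree v * f v) := by
    have := hf v
    linarith
  rw [h2, abs_mul, abs_mul, abs_of_pos hd] at h1
  have h3 := le_of_mul_le_mul_right (h1.trans_eq (one_mul _).symm) (by positivity)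
  have := (abs_le.1 h3).1
  linarith

/-- The substitution `f = D^{-1/2} x` removes the square roots from the eigenvector equation of the
normalized Laplacian. -/
theorem exists_eigenfunction (hG : ∀ v, 0 < G.degree v) {μ : ℝ} (hμ : μ ∈ spectrum ℝ (normLap G)) :
    ∃ f : V → ℝ, f ≠ 0 ∧
      ∀ v, G.degree v * f v - ∑ u ∈ G.neighborFinset v, f u = μ * (G.degree v * f v) := by
  rw [← Matrix.spectrum_toLin', ← Module.End.hasEigenvalue_iff_mem_spectrum] at hμ
  obtain ⟨x, hx⟩ := hμ.exists_hasEigenvector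
  have hs : ∀ v, √(G.degree v : ℝ) ≠ 0 := fun v => by
    have : (0 : ℝ) < G.degree v := by exact_mod_cast hG v
    positivity
  refine ⟨fun v => (√(G.degree v : ℝ))⁻¹ * x v, fun h => hx.2 (funext fun v => ?_), fun v => ?_⟩
  · have := congrFun h v
    exact (mul_eq_zero.1 this).resolve_left (inv_ne_zero (hs v))
  · have h := congrFun hx.apply_eq_smul v
    rw [Matrix.toLin'_apply, normLap, ← Matrix.mulVec_mulVec, ← Matrix.mulVec_mulVec,
      Matrix.mulVec_diagonal, SimpleGraph.lapMatrix_mulVec_apply] at h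
    simp only [Matrix.mulVec_diagonal, Pi.smul_apply, smul_eq_mul] at h
    have hd : (G.degree v : ℝ) = √(G.degree v : ℝ) * √(G.degree v : ℝ) :=
      (Real.mul_self_sqrt (Nat.cast_nonneg _)).symm
    have hs := hs v
    rw [inv_mul_eq_iff_eq_mul₀ hs] at h
    rw [h]
    nth_rewrite 2 [hd]
    field_simp

/-- A symmetric matrix with only zero eigenvalues vanishes, but the diagonal entries here are `1`.
This excludes the default value of `sInf` on the empty set in `kappa`. -/
theorem exists_ne_zero_mem_spectrum [Nonempty V] (hG : ∀ v, 0 < G.degree v) :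
    (spectrum ℝ (normLap G) \ {0}).Nonempty := by
  have hH : (normLap G).IsHermitian := by
    rw [Matrix.IsHermitian, normLap, Matrix.conjTranspose_mul, Matrix.conjTranspose_mul,
      (SimpleGraph.isHermitian_lapMatrix ℝ G).eq, Matrix.diagonal_conjTranspose, ← mul_assoc]
    rfl
  by_contra hne
  rw [Set.not_nonempty_iff_eq_empty, Set.sdiff_eq_empty] at hne
  have hz : hH.eigenvalues = 0 := funext fun i => hne (hH.eigenvalues_mem_spectrum_real i)
  rw [hH.eigenvalues_eq_zero_iff] at hz
  obtain ⟨v⟩ := ‹Nonempty V›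
  have h := congrFun (congrFun hz v) v
  have hd : (0 : ℝ) < G.degree v := by exact_mod_cast hG v
  rw [normLap, Matrix.mul_diagonal, Matrix.diagonal_mul] at h
  simp [SimpleGraph.lapMatrix, SimpleGraph.degMatrix, (hG v).ne'] at h

theorem conductance_mul_vol_le (hG : ∀ v, 0 < G.degree v) (S : Finset V) (hS : S.Nonempty)
    (hvol : vol G S ≤ vol G Sᶜ) : conductance G * vol G S ≤ (G.interedges S Sᶜ).card := by
  have hv : 0 < vol G S :=
    Finset.sum_pos (fun v _ => by exact_mod_cast hG v) hS
  have hSc : Sᶜ.Nonempty := by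
    rw [Finset.nonempty_iff_ne_empty]
    intro h
    rw [h] at hvol
    simp [vol] at hvol hv
    linarith
  have hle : conductance G ≤ (G.interedges S Sᶜ).card / min (vol G S) (vol G Sᶜ) := by
    refine ciInf_le ⟨0, ?_⟩ (⟨S, hS, hSc⟩ : {S : Finset V // S.Nonempty ∧ Sᶜ.Nonempty})
    rintro _ ⟨T, rfl⟩
    positivity
  rwa [min_eq_left hvol, le_div_iff₀ hv] at hle

theorem kappa_bounds [Nonempty V] (hG : ∀ v, 0 < G.degree v) {φ : ℝ} (hφ : 0 < φ)
    (hφ' : φ ≤ conductance G) : 0 < kappa G ∧ kappa G ≤ 4 / φ ^ 2 := by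
  have hcond : ∀ S : Finset V, S.Nonempty → vol G S ≤ vol G Sᶜ →
      φ * vol G S ≤ (G.interedges S Sᶜ).card := fun S hS hvol =>
    (mul_le_mul_of_nonneg_right hφ' (Finset.sum_nonneg fun _ _ => Nat.cast_nonneg _)).trans
      (conductance_mul_vol_le hG S hS hvol)
  have hlow : ∀ μ ∈ spectrum ℝ (normLap G) \ {0}, φ ^ 2 / 2 ≤ μ := fun μ hμ => by
    obtain ⟨f, hf0, hf⟩ := exists_eigenfunction hG hμ.1
    exact sq_le_of_eigenfunction hφ.le hcond hG hf hf0 hμ.2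
  have hup : ∀ μ ∈ spectrum ℝ (normLap G), μ ≤ 2 := fun μ hμ => by
    obtain ⟨f, hf0, hf⟩ := exists_eigenfunction hG hμ
    exact abs_one_sub_le_of_eigenfunction hG hf hf0
  obtain ⟨μ, hμ⟩ := exists_ne_zero_mem_spectrum hG
  have hinf : φ ^ 2 / 2 ≤ sInf (spectrum ℝ (normLap G) \ {0}) := le_csInf ⟨μ, hμ⟩ hlow
  have hsup : sSup (spectrum ℝ (normLap G)) ≤ 2 := csSup_le ⟨μ, hμ.1⟩ hup
  have hsup0 : μ ≤ sSup (spectrum ℝ (normLap G)) := le_csSup ⟨2, hup⟩ hμ.1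
  have hμ0 := hlow μ hμ
  have hφ2 : 0 < φ ^ 2 / 2 := by positivity
  refine ⟨div_pos (by linarith) (by linarith), ?_⟩
  calc kappa G ≤ 2 / (φ ^ 2 / 2) := by unfold kappa; gcongr
    _ = 4 / φ ^ 2 := by field_simp; ring

end Cheeger

/-! ### Polylogarithmic truncation length on expanders. -/

section Expander

variable {V : Type} [Fintype V] [DecidableEq V] {G : SimpleGraph V} [DecidableRel G.Adj]

theorem log_card_div_ge (hV : 2 ≤ Fintype.card V) {ε : ℝ} (hε : 0 < ε) (hε1 : ε < 1) :
    1 / 2 ≤ Real.log (Fintype.card V / ε) ∧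
      Real.log (Fintype.card V) ≤ Real.log (Fintype.card V / ε) := by
  have h2 : (2 : ℝ) ≤ Fintype.card V := by exact_mod_cast hV
  have h3 : (Fintype.card V : ℝ) ≤ Fintype.card V / ε := le_div_self (by positivity) hε hε1.le
  have h4 := Real.log_le_log (by positivity) h3
  have := Real.log_le_log two_pos h2
  have := Real.log_two_gt_d9
  exact ⟨by linarith, h4⟩

theorem truncLen_bounds [Nonempty V] (hG : ∀ v, 0 < G.degree v) {ε K : ℝ} {a : ℕ} (hK : 0 < K)
    (hlog : 1 / 2 ≤ Real.log (Fintype.card V / ε))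
    (hφ : 1 / (K * Real.log (Fintype.card V / ε) ^ a) ≤ conductance G) :
    1 ≤ truncLen G ε ∧ (truncLen G ε : ℝ) ≤
      (8 * K ^ 2 + 2 * 2 ^ (2 * a)) * Real.log (Fintype.card V / ε) ^ (2 * a + 1) := by
  unfold truncLen
  set x := Real.log (Fintype.card V / ε) with hx
  have hx0 : 0 < x := by linarith
  obtain ⟨hκ0, hκ⟩ := kappa_bounds hG (by positivity) hφ
  have hpos : 0 < 2 * kappa G * x := by positivity
  refine ⟨Nat.one_le_iff_ne_zero.2 (Nat.ceil_pos.2 hpos).ne', ?_⟩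
  -- Since `x ≥ 1/2`, the power `(2 x) ^ (2 a + 1)` is at least `1` and absorbs the rounding of the
  -- ceiling.
  have h1 : 1 ≤ 2 * 2 ^ (2 * a) * x ^ (2 * a + 1) := by
    have : (1 : ℝ) ≤ (2 * x) ^ (2 * a + 1) := one_le_pow₀ (by linarith)
    rw [mul_pow, pow_succ 2] at this
    linarith
  calc (⌈2 * kappa G * x⌉₊ : ℝ) ≤ 2 * kappa G * x + 1 := (Nat.ceil_lt_add_one hpos.le).le
    _ ≤ 2 * (4 / (1 / (K * x ^ a)) ^ 2) * x + 2 * 2 ^ (2 * a) * x ^ (2 * a + 1) := by gcongr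
    _ = _ := by
      field_simp
      ring

end Expander

end LocalER
end

theorem theorem4 :
    ∃ C : ℝ, 0 < C ∧
      -- all connected graphs and all truncation lengths
      (∀ (V : Type) [Fintype V] [DecidableEq V] (G : SimpleGraph V) [DecidableRel G.Adj]
        (N : LocalER.AdjLists G) (s t : V) (L : ℕ) (ε : ℝ),
        G.Connected → 2 ≤ Fintype.card V → 1 ≤ L → 0 < ε → ε < 1 →
        LocalER.AccurateWithProb N s t L ε (C / Fintype.card V) ∧
        LocalER.RunsWithin N s t L ε
          (C * (L : ℝ) ^ 4 * Real.log (Fintype.card V) *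
            (√(LocalER.minDeg G s t : ℝ) / ε))) ∧
      -- expanders, with the truncation length `⌈2 κ log (n / ε)⌉`
      (∀ (K : ℝ) (a : ℕ), 0 < K → ∃ (C' : ℝ) (a' : ℕ), 0 < C' ∧
        ∀ (V : Type) [Fintype V] [DecidableEq V] (G : SimpleGraph V) [DecidableRel G.Adj]
          (N : LocalER.AdjLists G) (s t : V) (ε : ℝ),
          G.Connected → 2 ≤ Fintype.card V → 0 < ε → ε < 1 →
          1 / (K * Real.log (Fintype.card V / ε) ^ a) ≤ LocalER.conductance G →
          LocalER.AccurateWithProb N s t (LocalER.truncLen G ε) ε (C / Fintype.card V) ∧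
          LocalER.RunsWithin N s t (LocalER.truncLen G ε) ε
            (C' * Real.log (Fintype.card V / ε) ^ a' *
              (√(LocalER.minDeg G s t : ℝ) / ε))) := by
  -- The running time dictates the constant; the error probability needs only `8`.
  refine ⟨1000, by norm_num, ?_, ?_⟩
  · intro V _ _ G _ N s t L ε hconn hV hL hε hε1
    have hG := LocalER.degree_pos_of_connected hconn hV
    exact ⟨LocalER.accurateWithProb N hG hV s t hL hε hε1 (by norm_num),
      LocalER.runsWithin N hG hV s t hL hε hε1⟩
  · intro K a hK
    -- The fourth power of the bound on the truncation length, and one more logarithm from `log n ≤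
    -- log (n / ε)`.
    refine ⟨1000 * (8 * K ^ 2 + 2 * 2 ^ (2 * a)) ^ 4, (2 * a + 1) * 4 + 1, by positivity, ?_⟩
    intro V _ _ G _ N s t ε hconn hV hε hε1 hφ
    have hG := LocalER.degree_pos_of_connected hconn hV
    have : Nonempty V := ⟨s⟩
    obtain ⟨hlog, hlog'⟩ := LocalER.log_card_div_ge hV hε hε1
    obtain ⟨hL, hL'⟩ := LocalER.truncLen_bounds hG hK hlog hφ
    refine ⟨LocalER.accurateWithProb N hG hV s t hL hε hε1 (by norm_num), fun x hx =>
      (LocalER.runsWithin N hG hV s t hL hε hε1 x hx).trans ?_⟩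
    have h0 : 0 ≤ Real.log (Fintype.card V : ℝ) := Real.log_natCast_nonneg _
    calc 1000 * (LocalER.truncLen G ε : ℝ) ^ 4 * Real.log (Fintype.card V) *
          (√(LocalER.minDeg G s t : ℝ) / ε)
        ≤ 1000 * ((8 * K ^ 2 + 2 * 2 ^ (2 * a)) *
            Real.log (Fintype.card V / ε) ^ (2 * a + 1)) ^ 4 *
            Real.log (Fintype.card V / ε) * (√(LocalER.minDeg G s t : ℝ) / ε) := by gcongr
      _ = _ := by ring
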